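/- **Definitions.** Let $\mathbb F$ be a field of characteristic zero, let $T, z$ be variables and $\mathbf x=(x_1,\dots,x_n)$. An *algebraic circuit* over $\mathbb F$ is a finite directed acyclic graph whose leaves are labelled by variables or elements of $\mathbb F$, and whose internal nodes are sum or product gates of unbounded fan-in; its *size* is the number of edges and its *depth* is the length of a longest path from a leaf to the output node. "Depth $\Delta$ and size $s$" means depth at most $\Delta$ and size at most $s$. A polynomial $A(T,\mathbf x,z)\in\mathbb F[T,\mathbf x,z]$ is *monic in $z$* if its leading coefficient, as a polynomial in $z$ over $\mathbb F[T,\mathbf x]$, is a nonzero element of $\mathbb F$; it is *$T$-regularized* if $A(0,\mathbf x,z)\in\mathbb F[z]$. A polynomial $\Phi(T,\mathbf x)\in\mathbb F[T,\mathbf x]$ is a *truncated, non-degenerate, approximate $z$-root of $A$ of order $k$* if $A(T,\mathbf x,\Phi(T,\mathbf x))\equiv 0 \bmod T^k$, $\deg_T\Phi<k$, and $(\partial_z A)(0,\mathbf 0,\Phi(0,\mathbf 0))\ne 0$. An *$(n,\sigma,\mu,\rho)$-design* is a family $\mathcal S=(S_1,\dots,S_n)$ of subsets of $[\mu]$ with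 $|S_i|=\sigma$ for all $i$ and $|S_i\cap S_j|<\rho$ for all $i\neq j$. For a $\sigma$-variate polynomial $g$ over $\mathbb F$ and variables $\mathbf w=(w_1,\dots,w_\mu)$, set $\mathbf{KI}_{g,\mathcal S}(\mathbf w):=(g(\mathbf w_{S_1}),\dots,g(\mathbf w_{S_n}))$, where $\mathbf w_{S_i}$ is the tuple of the $w_j$, $j\in S_i$, in increasing order of $j$. **Theorem.** There are an absolute constant $c\in\mathbb N$ and absolute polynomials $p\in\mathbb N[a_1,a_2,a_3]$ and $q\in\mathbb N[t]$ such that the following holds for every field $\mathbb F$ of characteristic zero and all $n,\ell,k,\Delta,s,\sigma,\mu,\rho\in\mathbb N$ with $k>1$. For every $i\in[\ell]$, let $A_i\in\mathbb F[T,\mathbf x,z]$ be computable by a circuit of depth $\Delta$ and size $s$, $T$-regularized and monic in $z$, and let $\Phi_i\in\mathbb F[T,\mathbf x]$ be a truncated, non-degenerate, approximate $z$-root of $A_i$ of order $k$. Let $\mathcal S$ be an $(n,\sigma,\mu,\rho)$-design and let $g$ be a $\sigma$-variate polynomial over $\mathbb F$ of degree $d$. Let $C$ be a circuit over $\mathbb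 F$ of depth $\Delta$ and size $s$ in the variables $T,\mathbf x$ and $\ell$ further variables, such that $$C'(T,\mathbf x):=C(T,\mathbf x,\Phi_1,\dots,\Phi_\ell)$$ is nonzero. If $C'(T,\mathbf{KI}_{g,\mathcal S}(\mathbf w))$ is identically zero, then $g$ can be computed by an algebraic circuit over $\mathbb F$ of depth at most $c\,\Delta$ and size at most $$p(s,\deg C',k)\cdot(\rho\log_2 k)^{q(d)},$$ where $\deg C'$ is the total degree of $C'$. -/

import Mathlib

/-! ## Algebraic circuits -/

/-- The label of a node of an algebraic circuit over `F` in the variables `V`, with nodes `N`: a leaf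
carries a variable or a field constant, an internal node is a sum or a product gate of unbounded
fan-in, given by the multiset of its inputs (parallel edges are allowed). A gate without inputs
computes the constant `0` or `1`, as a constant leaf would. -/
inductive Gate (F V N : Type*) where
  | var (v : V) : Gate F V N
  | const (a : F) : Gate F V N
  | add (l : Multiset N) : Gate F V N
  | mul (l : Multiset N) : Gate F V N

/-- The multiset of nodes with an edge into the given one. -/
def Gate.inputs {F V N : Type*} : Gate F V N → Multiset N
  | .var _ => 0
  | .const _ => 0
  | .add l => l
  | .mul l => l

/-- An algebraic circuit: a finite directed graph of labelled nodes with an output node. It is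
acyclic, which is witnessed by a topological numbering `rank`. -/
structure Circuit (F V : Type*) where
  Node : Type
  fintypeNode : Fintype Node
  gate : Node → Gate F V Node
  rank : Node → ℕ
  rank_lt : ∀ a : Node, ∀ b ∈ (gate a).inputs, rank b < rank a
  out : Node

/-- The polynomial computed at a node. -/
noncomputable def Circuit.nodePoly {F V : Type*} [CommSemiring F] (C : Circuit F V) (a : C.Node) :
    MvPolynomial V F :=
  match h : C.gate a with
  | .var v => MvPolynomial.X v
  | .const c => MvPolynomial.C c
  | .add l => (l.attach.map fun b => C.nodePoly b.1).sum
  | .mul l => (l.attach.map fun b => C.nodePoly b.1).prod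
termination_by C.rank a
decreasing_by
  all_goals exact C.rank_lt a b.1 (by rw [h]; exact b.2)

/-- The length of a longest directed path from a leaf to the node. -/
def Circuit.nodeDepth {F V : Type*} (C : Circuit F V) (a : C.Node) : ℕ :=
  match h : C.gate a with
  | .var _ => 0
  | .const _ => 0
  | .add l => (l.attach.map fun b => C.nodeDepth b.1).sup + 1
  | .mul l => (l.attach.map fun b => C.nodeDepth b.1).sup + 1
termination_by C.rank a
decreasing_by
  all_goals exact C.rank_lt a b.1 (by rw [h]; exact b.2)

theorem Circuit.nodePoly_eq {F V : Type*} [CommSemiring F] (C : Circuit F V) (a : C.Node) :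
    C.nodePoly a = match C.gate a with
      | .var v => MvPolynomial.X v
      | .const c => MvPolynomial.C c
      | .add l => (l.map C.nodePoly).sum
      | .mul l => (l.map C.nodePoly).prod := by
  rw [Circuit.nodePoly.eq_def]
  split <;> rename_i h <;> simp [h]

theorem Circuit.nodeDepth_eq {F V : Type*} (C : Circuit F V) (a : C.Node) :
    C.nodeDepth a = match C.gate a with
      | .var _ => 0
      | .const _ => 0
      | .add l => (l.map C.nodeDepth).sup + 1
      | .mul l => (l.map C.nodeDepth).sup + 1 := by
  rw [Circuit.nodeDepth.eq_def]
  split <;> rename_i h <;> simp [h]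

/-- The polynomial computed by a circuit. -/
noncomputable def Circuit.poly {F V : Type*} [CommSemiring F] (C : Circuit F V) :
    MvPolynomial V F :=
  C.nodePoly C.out

/-- The depth: the length of a longest path from a leaf to the output node. -/
def Circuit.depth {F V : Type*} (C : Circuit F V) : ℕ :=
  C.nodeDepth C.out

/-- The size: the number of edges. -/
def Circuit.size {F V : Type*} (C : Circuit F V) : ℕ :=
  letI := C.fintypeNode
  ∑ a : C.Node, (C.gate a).inputs.card

/-! ## Polynomials in `T, x₁, …, xₙ` and in `T, x₁, …, xₙ, z`

`TX n` indexes the variables `T = none` and `xᵢ = some i`; `TXZ n` indexes in addition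
`z = none`, with `T = some none` and `xᵢ = some (some i)`. -/

abbrev TX (n : ℕ) : Type := Option (Fin n)

abbrev TXZ (n : ℕ) : Type := Option (TX n)

section

variable {F : Type*} [Field F] {n : ℕ}

/-- `P` is monic in `z`: its leading coefficient as a polynomial in `z` over `F[T, x]` is a nonzero
element of `F`. -/
def MonicInZ (P : MvPolynomial (TXZ n) F) : Prop :=
  ∃ c : F, c ≠ 0 ∧
    (MvPolynomial.optionEquivLeft F (TX n) P).leadingCoeff = MvPolynomial.C c

/-- The polynomial `P(0, x, z)`. -/
noncomputable def setTZero (P : MvPolynomial (TXZ n) F) : MvPolynomial (TXZ n) F :=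
  MvPolynomial.aeval (fun v : TXZ n => if v = some none then 0 else MvPolynomial.X v) P

/-- `P` is `T`-regularized: `P(0, x, z)` lies in `F[z]`. -/
def TRegularized (P : MvPolynomial (TXZ n) F) : Prop :=
  ∃ p : Polynomial F,
    setTZero P = Polynomial.aeval (MvPolynomial.X none : MvPolynomial (TXZ n) F) p

/-- The polynomial `P(T, x, Φ(T, x))`. -/
noncomputable def substZ (P : MvPolynomial (TXZ n) F) (Φ : MvPolynomial (TX n) F) :
    MvPolynomial (TX n) F :=
  MvPolynomial.aeval (fun v : TXZ n => v.elim Φ MvPolynomial.X) P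

/-- `Φ` is an approximate `z`-root of `P` of order `k`: `P(T, x, Φ(T, x)) ≡ 0 mod T ^ k`. -/
def IsApproxRoot (P : MvPolynomial (TXZ n) F) (Φ : MvPolynomial (TX n) F) (k : ℕ) : Prop :=
  (MvPolynomial.X none : MvPolynomial (TX n) F) ^ k ∣ substZ P Φ

/-- `Φ` is truncated at order `k`: its degree in `T` is less than `k`. -/
def IsTruncated (Φ : MvPolynomial (TX n) F) (k : ℕ) : Prop :=
  MvPolynomial.degreeOf none Φ < k

/-- `Φ` is non-degenerate for `P`: `(∂P/∂z)(0, 0, Φ(0, 0)) ≠ 0`. -/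
def IsNondegenerate (P : MvPolynomial (TXZ n) F) (Φ : MvPolynomial (TX n) F) : Prop :=
  MvPolynomial.eval
    (fun v : TXZ n => v.elim (MvPolynomial.eval (fun _ => 0) Φ) (fun _ => 0))
    (MvPolynomial.pderiv none P) ≠ 0

end

/-! ## Designs and the Kabanets-Impagliazzo generator -/

/-- `S` is an `(n, σ, μ, ρ)`-design. -/
structure IsDesign (n σ μ ρ : ℕ) (S : Fin n → Finset (Fin μ)) : Prop where
  card_eq : ∀ i, (S i).card = σ
  card_inter_lt : ∀ i j, i ≠ j → (S i ∩ S j).card < ρ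

section

variable {F : Type*} [Field F] {n σ μ : ℕ}

/-- The `i`-th coordinate `gᵢ(w) = g(w restricted to Sᵢ)` of the Kabanets-Impagliazzo generator; the
elements of `Sᵢ` are taken in increasing order. -/
noncomputable def kiCoord (g : MvPolynomial (Fin σ) F) (S : Fin n → Finset (Fin μ))
    (hS : ∀ i, (S i).card = σ) (i : Fin n) : MvPolynomial (Fin μ) F :=
  MvPolynomial.rename ((S i).orderEmbOfFin (hS i)) g

/-- The polynomial `f(T, KI_{g,S}(w))` in `F[T, w]`. -/
noncomputable def compKI (g : MvPolynomial (Fin σ) F) (S : Fin n → Finset (Fin μ))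
    (hS : ∀ i, (S i).card = σ) (f : MvPolynomial (TX n) F) : MvPolynomial (TX μ) F :=
  MvPolynomial.aeval
    (fun v : TX n =>
      v.elim (MvPolynomial.X none) (fun i => MvPolynomial.rename some (kiCoord g S hS i))) f

/-- The polynomial `C(T, x, Φ₁, …, Φ_ℓ)`. -/
noncomputable def substRoots {ℓ : ℕ} (P : MvPolynomial (TX n ⊕ Fin ℓ) F)
    (Φ : Fin ℓ → MvPolynomial (TX n) F) : MvPolynomial (TX n) F :=
  MvPolynomial.aeval (Sum.elim MvPolynomial.X Φ) P

end

/-! If the generator fails to hit C', then g is a root of a polynomial with a small shallow circuit,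
and roots of such polynomials again have small shallow circuits. Every step must keep the depth
linear in Δ.

Hybrid argument (`exists_hybrid`). Replace x_1, x_2, … one by one by the coordinates of the
generator. C' is nonzero at the start and zero at the end, so it dies at some x_i. Fix T, the later
x_j and the variables w outside S_i at constants that keep it nonzero just before that step. Writing
y for x_i, this gives a nonzero P(y, w) with P(g(w), w) = 0. By the design property each earlier
coordinate is now a polynomial of degree at most d in fewer than ρ variables, hence a combination of
at most ρ^d monomials.

Roots of circuits (`Gen.root_of_circuit`). Suppose 𝒜(0, z) has constant coefficients and a simple
zero at z = 0 with slope ξ. Then G = z - 𝒜/ξ lies in the ideal (T, z²), and a root u of 𝒜 modulo T^k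
with T ∣ u is given by Lagrange inversion: u ≡ ∑_{m < 2k} [z^m] G^(m+1) / (m+1) modulo T^k. The
formula is explicit, so there is no iteration to pay for in depth. The substitution T = y², z = ζ y
turns the coefficients of G^(m+1) into coefficients of univariate polynomials in y, recovered by
interpolating in ζ; the powers themselves are computed by evaluation at integers and interpolation.
What is left is substitution into a circuit with truncation at every gate (`Gen.coeff_aeval`), which
multiplies the depth by 5.

This is used twice. For Φ_i (`Gen.approxRoot`), translate z by α = Φ_i(0, 0); T-regularity makes
A_i(0, x, z + α) independent of x. So P has a circuit (`exists_circuit_substRoots`): evaluate the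
coordinates, then the Φ_i, then C. For g (`Circuit.exists_circuit_root`), deform along the line b +
T(w - b) and take T = 1; the degree of g in T is at most d, so the order d + 1 loses nothing. If g
is a multiple root of P, the Taylor coefficient of P in y one order below the multiplicity has g as
a simple root, in characteristic zero (`Circuit.exists_circuit_root_of_ne_zero`).

Costs are tracked by `Gen`, in which depth adds under composition and shared intermediate results
are paid for once. -/

/-! ## A cost calculus for shared computations -/

namespace Circuit

variable {F V : Type*}

/-- The gate obtained by renaming the inputs. -/
def _root_.Gate.mapNode {N N' : Type*} (f : N → N') : Gate F V N → Gate F V N'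
  | .var v => .var v
  | .const a => .const a
  | .add l => .add (l.map f)
  | .mul l => .mul (l.map f)

theorem _root_.Gate.inputs_mapNode {N N' : Type*} (f : N → N') (g : Gate F V N) :
    (g.mapNode f).inputs = g.inputs.map f := by
  cases g <;> simp [Gate.mapNode, Gate.inputs]

/-- Add a node with a prescribed gate on top of a circuit. -/
def addNode (C : Circuit F V) (g : Gate F V C.Node) : Circuit F V where
  Node := Option C.Node
  fintypeNode := letI := C.fintypeNode; inferInstance
  gate a := a.elim (g.mapNode some) fun b => (C.gate b).mapNode some
  rank a := a.elim ((letI := C.fintypeNode; Finset.univ.sup C.rank) + 1) C.rank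
  rank_lt := by
    let := C.fintypeNode
    rintro (_ | a) b hb
    · simp only [Option.elim, Gate.inputs_mapNode, Multiset.mem_map] at hb ⊢
      obtain ⟨c, -, rfl⟩ := hb
      exact Nat.lt_succ_of_le (Finset.le_sup (f := C.rank) (Finset.mem_univ c))
    · simp only [Option.elim, Gate.inputs_mapNode, Multiset.mem_map] at hb ⊢
      obtain ⟨c, hc, rfl⟩ := hb
      exact C.rank_lt a c hc
  out := none

theorem addNode_size (C : Circuit F V) (g : Gate F V C.Node) :
    (C.addNode g).size = C.size + g.inputs.card := by
  let := C.fintypeNode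
  have : (C.addNode g).size = ∑ a : Option C.Node, ((C.addNode g).gate a).inputs.card := by
    unfold size
    congr 1
  rw [this, Fintype.sum_option, add_comm]
  simp [addNode, Gate.inputs_mapNode, size]

/-- A node of the old circuit, in the extended one. -/
def oldNode (C : Circuit F V) (g : Gate F V C.Node) (a : C.Node) : (C.addNode g).Node :=
  some a

/-- The added node. -/
def newNode (C : Circuit F V) (g : Gate F V C.Node) : (C.addNode g).Node :=
  none

theorem addNode_gate_oldNode (C : Circuit F V) (g : Gate F V C.Node) (a : C.Node) :
    (C.addNode g).gate (C.oldNode g a) = (C.gate a).mapNode (C.oldNode g) :=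
  rfl

theorem addNode_gate_newNode (C : Circuit F V) (g : Gate F V C.Node) :
    (C.addNode g).gate (C.newNode g) = g.mapNode (C.oldNode g) :=
  rfl

/-- The value at a node depends only on the gates below it, so a map that commutes with the gates
preserves it, injective or not. Induction on the rank. -/
theorem nodeDepth_map {C C' : Circuit F V} {f : C.Node → C'.Node}
    (hf : ∀ a, C'.gate (f a) = (C.gate a).mapNode f) (a : C.Node) :
    C'.nodeDepth (f a) = C.nodeDepth a := by
  induction h : C.rank a using Nat.strong_induction_on generalizing a with
  | _ r ih =>
    have hin : ∀ b ∈ (C.gate a).inputs, C'.nodeDepth (f b) = C.nodeDepth b :=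
      fun b hb => ih _ (h ▸ C.rank_lt a b hb) b rfl
    rw [nodeDepth_eq, nodeDepth_eq C, hf]
    cases hg : C.gate a with
    | var v => rfl
    | const c => rfl
    | add l =>
      rw [hg] at hin
      simp only [Gate.mapNode, Multiset.map_map]
      congr 2
      exact Multiset.map_congr rfl hin
    | mul l =>
      rw [hg] at hin
      simp only [Gate.mapNode, Multiset.map_map]
      congr 2
      exact Multiset.map_congr rfl hin

theorem nodePoly_map [CommSemiring F] {C C' : Circuit F V} {f : C.Node → C'.Node}
    (hf : ∀ a, C'.gate (f a) = (C.gate a).mapNode f) (a : C.Node) :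
    C'.nodePoly (f a) = C.nodePoly a := by
  induction h : C.rank a using Nat.strong_induction_on generalizing a with
  | _ r ih =>
    have hin : ∀ b ∈ (C.gate a).inputs, C'.nodePoly (f b) = C.nodePoly b :=
      fun b hb => ih _ (h ▸ C.rank_lt a b hb) b rfl
    rw [nodePoly_eq, nodePoly_eq C, hf]
    cases hg : C.gate a with
    | var v => rfl
    | const c => rfl
    | add l =>
      rw [hg] at hin
      simp only [Gate.mapNode, Multiset.map_map]
      congr 1
      exact Multiset.map_congr rfl hin
    | mul l =>
      rw [hg] at hin
      simp only [Gate.mapNode, Multiset.map_map]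
      congr 1
      exact Multiset.map_congr rfl hin

/-- Some node of the circuit computes `p` in depth at most `t`. -/
def Has [CommSemiring F] (C : Circuit F V) (p : MvPolynomial V F) (t : ℕ) : Prop :=
  ∃ a, C.nodePoly a = p ∧ C.nodeDepth a ≤ t

theorem Has.addNode [CommSemiring F] {C : Circuit F V} {p : MvPolynomial V F} {t : ℕ}
    (h : C.Has p t) (g : Gate F V C.Node) : (C.addNode g).Has p t := by
  obtain ⟨a, h1, h2⟩ := h
  exact ⟨C.oldNode g a, by rw [nodePoly_map (C.addNode_gate_oldNode g), h1],
    by rwa [nodeDepth_map (C.addNode_gate_oldNode g)]⟩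

theorem has_addNode_var [CommSemiring F] (C : Circuit F V) (v : V) :
    (C.addNode (.var v)).Has (MvPolynomial.X v) 0 :=
  ⟨C.newNode _, by rw [nodePoly_eq, addNode_gate_newNode]; rfl,
    by rw [nodeDepth_eq, addNode_gate_newNode]; rfl⟩

theorem has_addNode_const [CommSemiring F] (C : Circuit F V) (c : F) :
    (C.addNode (.const c)).Has (MvPolynomial.C c) 0 :=
  ⟨C.newNode _, by rw [nodePoly_eq, addNode_gate_newNode]; rfl,
    by rw [nodeDepth_eq, addNode_gate_newNode]; rfl⟩

theorem has_addNode_add [CommSemiring F] (C : Circuit F V) (l : Multiset C.Node) (t : ℕ)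
    (h : ∀ a ∈ l, C.nodeDepth a ≤ t) :
    (C.addNode (.add l)).Has (l.map C.nodePoly).sum (t + 1) := by
  refine ⟨C.newNode _, ?_, ?_⟩
  · rw [nodePoly_eq, addNode_gate_newNode]
    simp only [Gate.mapNode, Multiset.map_map]
    congr 1
    exact Multiset.map_congr rfl fun a _ => nodePoly_map (C.addNode_gate_oldNode _) a
  · rw [nodeDepth_eq, addNode_gate_newNode]
    simp only [Gate.mapNode, Multiset.map_map, add_le_add_iff_right, Multiset.sup_le, Multiset.mem_map]
    rintro _ ⟨a, ha, rfl⟩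
    exact (nodeDepth_map (C.addNode_gate_oldNode _) a).trans_le (h a ha)

theorem has_addNode_mul [CommSemiring F] (C : Circuit F V) (l : Multiset C.Node) (t : ℕ)
    (h : ∀ a ∈ l, C.nodeDepth a ≤ t) :
    (C.addNode (.mul l)).Has (l.map C.nodePoly).prod (t + 1) := by
  refine ⟨C.newNode _, ?_, ?_⟩
  · rw [nodePoly_eq, addNode_gate_newNode]
    simp only [Gate.mapNode, Multiset.map_map]
    congr 1
    exact Multiset.map_congr rfl fun a _ => nodePoly_map (C.addNode_gate_oldNode _) a
  · rw [nodeDepth_eq, addNode_gate_newNode]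
    simp only [Gate.mapNode, Multiset.map_map, add_le_add_iff_right, Multiset.sup_le, Multiset.mem_map]
    rintro _ ⟨a, ha, rfl⟩
    exact (nodeDepth_map (C.addNode_gate_oldNode _) a).trans_le (h a ha)

/-- The circuit with a single constant leaf. -/
def ofConst (c : F) : Circuit F V where
  Node := Unit
  fintypeNode := inferInstance
  gate _ := .const c
  rank _ := 0
  rank_lt := by simp [Gate.inputs]
  out := ()

theorem ofConst_poly [CommSemiring F] (c : F) :
    (ofConst c : Circuit F V).poly = MvPolynomial.C c := by
  rw [poly, nodePoly_eq]; rfl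

theorem ofConst_depth (c : F) : (ofConst c : Circuit F V).depth = 0 := by
  rw [depth, nodeDepth_eq]; rfl

theorem ofConst_size (c : F) : (ofConst c : Circuit F V).size = 0 :=
  Finset.sum_eq_zero fun _ _ => rfl

end Circuit

/-! ### Computability of sets of polynomials with given extra depth and number of edges -/

section Calculus

variable {F V : Type*} [Field F]

/-- The polynomial `p` is available at depth at most `t`. -/
def Avail (W : Set (MvPolynomial V F × ℕ)) (p : MvPolynomial V F) (t : ℕ) : Prop :=
  ∃ t' ≤ t, (p, t') ∈ W

/-- `Extends W e W'`: the available polynomials `W` are extended to `W'` by sum and product gates with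
`e` edges in total. -/
inductive Extends (W : Set (MvPolynomial V F × ℕ)) : ℕ → Set (MvPolynomial V F × ℕ) → Prop
  | refl : Extends W 0 W
  | add {e : ℕ} {W' : Set (MvPolynomial V F × ℕ)} (l : Multiset (MvPolynomial V F)) (t : ℕ) :
      Extends W e W' → (∀ p ∈ l, Avail W' p t) → Extends W (e + l.card) (insert (l.sum, t + 1) W')
  | mul {e : ℕ} {W' : Set (MvPolynomial V F × ℕ)} (l : Multiset (MvPolynomial V F)) (t : ℕ) :
      Extends W e W' → (∀ p ∈ l, Avail W' p t) → Extends W (e + l.card) (insert (l.prod, t + 1) W')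

theorem Avail.mono {W W' : Set (MvPolynomial V F × ℕ)} {p : MvPolynomial V F} {t t' : ℕ}
    (h : Avail W p t) (hW : W ⊆ W') (ht : t ≤ t') : Avail W' p t' :=
  let ⟨a, h1, h2⟩ := h
  ⟨a, h1.trans ht, hW h2⟩

theorem Extends.subset {W W' : Set (MvPolynomial V F × ℕ)} {e : ℕ} (h : Extends W e W') : W ⊆ W' := by
  induction h with
  | refl => exact subset_rfl
  | add l t _ _ ih => exact ih.trans (Set.subset_insert _ _)
  | mul l t _ _ ih => exact ih.trans (Set.subset_insert _ _)

theorem Extends.trans {W W' W'' : Set (MvPolynomial V F × ℕ)} {e e' : ℕ} (h : Extends W e W')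
    (h' : Extends W' e' W'') : Extends W (e + e') W'' := by
  induction h' with
  | refl => exact h
  | add l t _ hl ih => rw [← add_assoc]; exact ih.add l t hl
  | mul l t _ hl ih => rw [← add_assoc]; exact ih.mul l t hl

/-- The leaves: variables and constants, at depth `0`. -/
def leafSet (F V : Type*) [Field F] : Set (MvPolynomial V F × ℕ) :=
  {x | ((∃ v, x.1 = MvPolynomial.X v) ∨ ∃ c, x.1 = MvPolynomial.C c) ∧ x.2 = 0}

theorem exists_nodes_of_avail (C : Circuit F V) (l : Multiset (MvPolynomial V F)) (t : ℕ)
    (h : ∀ p ∈ l, C.Has p t) :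
    ∃ m : Multiset C.Node, m.map C.nodePoly = l ∧ ∀ a ∈ m, C.nodeDepth a ≤ t := by
  induction l using Multiset.induction_on with
  | empty => exact ⟨0, by simp⟩
  | cons p l ih =>
    obtain ⟨m, h1, h2⟩ := ih fun q hq => h q (Multiset.mem_cons_of_mem hq)
    obtain ⟨a, h3, h4⟩ := h p (Multiset.mem_cons_self p l)
    refine ⟨a ::ₘ m, by simp [h1, h3], ?_⟩
    simp only [Multiset.mem_cons, forall_eq_or_imp]
    exact ⟨h4, h2⟩

/-- The leaf set is infinite while a circuit is finite, so only a finite set K of demands can be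
realised. Going back through the last gate, the demands become K without the new polynomial,
together with the inputs of that gate. Leaves have no incoming edges and cost nothing. -/
theorem Extends.exists_circuit {W : Set (MvPolynomial V F × ℕ)} {e : ℕ}
    (h : Extends (leafSet F V) e W) (K : Set (MvPolynomial V F × ℕ)) (hK : K.Finite) (hKW : K ⊆ W) :
    ∃ C : Circuit F V, C.size = e ∧ ∀ x ∈ K, C.Has x.1 x.2 := by
  classical
  induction h generalizing K with
  | refl =>
    induction K, hK using Set.Finite.induction_on with
    | empty => exact ⟨Circuit.ofConst 0, Circuit.ofConst_size _, by simp⟩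
    | @insert x K _ _ ih =>
      obtain ⟨C, h1, h2⟩ := ih ((Set.subset_insert _ _).trans hKW)
      obtain ⟨hx, hx0⟩ := hKW (Set.mem_insert x K)
      rcases hx with ⟨v, hv⟩ | ⟨c, hc⟩
      · refine ⟨C.addNode (.var v), by rw [Circuit.addNode_size, h1]; rfl, ?_⟩
        rintro y (rfl | hy)
        · rw [hv, hx0]; exact C.has_addNode_var v
        · exact (h2 y hy).addNode _
      · refine ⟨C.addNode (.const c), by rw [Circuit.addNode_size, h1]; rfl, ?_⟩
        rintro y (rfl | hy)
        · rw [hc, hx0]; exact C.has_addNode_const c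
        · exact (h2 y hy).addNode _
  | @add e W' l t _ hl ih =>
    choose! f hf1 hf2 using hl
    have hfin : ((fun p => (p, f p)) '' {p | p ∈ l}).Finite :=
      Set.Finite.image _ (by simp)
    obtain ⟨C, h1, h2⟩ := ih ((K \ {(l.sum, t + 1)}) ∪ (fun p => (p, f p)) '' {p | p ∈ l})
      (hK.sdiff.union hfin) (by
        rintro y (⟨hy, hne⟩ | ⟨p, hp, rfl⟩)
        · exact (hKW hy).resolve_left hne
        · exact hf2 p hp)
    obtain ⟨m, hm1, hm2⟩ := exists_nodes_of_avail C l t fun p hp => by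
      obtain ⟨a, ha, ha'⟩ := h2 _ (Or.inr ⟨p, hp, rfl⟩)
      exact ⟨a, ha, ha'.trans (hf1 p hp)⟩
    refine ⟨C.addNode (.add m), ?_, fun y hy => ?_⟩
    · rw [Circuit.addNode_size, h1, ← hm1, Multiset.card_map]; rfl
    · by_cases hy' : y = (l.sum, t + 1)
      · subst hy'
        simpa only [hm1] using C.has_addNode_add m t hm2
      · exact (h2 y (Or.inl ⟨hy, hy'⟩)).addNode _
  | @mul e W' l t _ hl ih =>
    choose! f hf1 hf2 using hl
    have hfin : ((fun p => (p, f p)) '' {p | p ∈ l}).Finite :=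
      Set.Finite.image _ (by simp)
    obtain ⟨C, h1, h2⟩ := ih ((K \ {(l.prod, t + 1)}) ∪ (fun p => (p, f p)) '' {p | p ∈ l})
      (hK.sdiff.union hfin) (by
        rintro y (⟨hy, hne⟩ | ⟨p, hp, rfl⟩)
        · exact (hKW hy).resolve_left hne
        · exact hf2 p hp)
    obtain ⟨m, hm1, hm2⟩ := exists_nodes_of_avail C l t fun p hp => by
      obtain ⟨a, ha, ha'⟩ := h2 _ (Or.inr ⟨p, hp, rfl⟩)
      exact ⟨a, ha, ha'.trans (hf1 p hp)⟩
    refine ⟨C.addNode (.mul m), ?_, fun y hy => ?_⟩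
    · rw [Circuit.addNode_size, h1, ← hm1, Multiset.card_map]; rfl
    · by_cases hy' : y = (l.prod, t + 1)
      · subst hy'
        simpa only [hm1] using C.has_addNode_mul m t hm2
      · exact (h2 y (Or.inl ⟨hy, hy'⟩)).addNode _

/-- The constant polynomials. -/
def constSet (F V : Type*) [Field F] : Set (MvPolynomial V F) := Set.range MvPolynomial.C

/-- From the polynomials in `S` and the constants, all polynomials in `X` can be computed by gates
with at most `e` edges that increase the depth by at most `δ`. -/
def Gen (S : Set (MvPolynomial V F)) (δ e : ℕ) (X : Set (MvPolynomial V F)) : Prop :=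
  ∀ (W : Set (MvPolynomial V F × ℕ)) (t : ℕ), (∀ p ∈ constSet F V, Avail W p 0) →
    (∀ p ∈ S, Avail W p t) →
    ∃ W' e', e' ≤ e ∧ Extends W e' W' ∧ ∀ p ∈ X, Avail W' p (t + δ)

variable {S S' X X' Y : Set (MvPolynomial V F)} {δ δ' e e' : ℕ}

theorem Gen.mono (h : Gen S δ e X) (hS : S ⊆ S' ∪ constSet F V) (hX : X' ⊆ X) (hδ : δ ≤ δ')
    (he : e ≤ e') : Gen S' δ' e' X' := by
  intro W t hc hW
  obtain ⟨W', e₁, h1, h2, h3⟩ := h W t hc fun p hp => (hS hp).elim (hW p)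
    fun hp => (hc p hp).mono subset_rfl (Nat.zero_le _)
  exact ⟨W', e₁, h1.trans he, h2, fun p hp => (h3 p (hX hp)).mono subset_rfl (by omega)⟩

theorem Gen.base (h : X ⊆ S ∪ constSet F V) : Gen S 0 0 X := by
  intro W t hc hW
  exact ⟨W, 0, le_rfl, .refl, fun p hp => (h hp).elim (hW p)
    fun hp => (hc p hp).mono subset_rfl (Nat.zero_le _)⟩

theorem Gen.sum {l : Multiset (MvPolynomial V F)} (h : ∀ p ∈ l, p ∈ S ∪ constSet F V) :
    Gen S 1 l.card {l.sum} := by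
  intro W t hc hW
  refine ⟨_, _, (zero_add _).le, Extends.add l t Extends.refl fun p hp => (h p hp).elim (hW p)
    fun hp => (hc p hp).mono subset_rfl (Nat.zero_le _), ?_⟩
  rintro p rfl
  exact ⟨t + 1, le_rfl, Set.mem_insert _ _⟩

theorem Gen.prod {l : Multiset (MvPolynomial V F)} (h : ∀ p ∈ l, p ∈ S ∪ constSet F V) :
    Gen S 1 l.card {l.prod} := by
  intro W t hc hW
  refine ⟨_, _, (zero_add _).le, Extends.mul l t Extends.refl fun p hp => (h p hp).elim (hW p)
    fun hp => (hc p hp).mono subset_rfl (Nat.zero_le _), ?_⟩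
  rintro p rfl
  exact ⟨t + 1, le_rfl, Set.mem_insert _ _⟩

theorem Gen.comp (h : Gen S δ e X) (h' : Gen X δ' e' Y) : Gen S (δ + δ') (e + e') Y := by
  intro W t hc hW
  obtain ⟨W₁, e₁, h1, h2, h3⟩ := h W t hc hW
  obtain ⟨W₂, e₂, h4, h5, h6⟩ := h' W₁ (t + δ)
    (fun p hp => (hc p hp).mono h2.subset le_rfl) h3
  exact ⟨W₂, _, add_le_add h1 h4, h2.trans h5, fun p hp => by rw [← add_assoc]; exact h6 p hp⟩

theorem Gen.union (h : Gen S δ e X) (h' : Gen S δ e' Y) : Gen S δ (e + e') (X ∪ Y) := by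
  intro W t hc hW
  obtain ⟨W₁, e₁, h1, h2, h3⟩ := h W t hc hW
  obtain ⟨W₂, e₂, h4, h5, h6⟩ := h' W₁ t (fun p hp => (hc p hp).mono h2.subset le_rfl)
    fun p hp => (hW p hp).mono h2.subset le_rfl
  exact ⟨W₂, _, add_le_add h1 h4, h2.trans h5, fun p hp => hp.elim
    (fun hp => (h3 p hp).mono h5.subset le_rfl) (h6 p)⟩

theorem Gen.keep (h : Gen S δ e X) : Gen S δ e (X ∪ S) := by
  simpa using h.union ((Gen.base (S := S) (X := S) Set.subset_union_left).mono
    Set.subset_union_left subset_rfl (Nat.zero_le δ) le_rfl)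

theorem Gen.biUnion {ι : Type*} (I : Finset ι) {e : ι → ℕ} {X : ι → Set (MvPolynomial V F)}
    (h : ∀ i ∈ I, Gen S δ (e i) (X i)) : Gen S δ (∑ i ∈ I, e i) (⋃ i ∈ I, X i) := by
  classical
  induction I using Finset.induction_on with
  | empty =>
    simpa using (Gen.base (S := S) (X := ∅) (by simp)).mono Set.subset_union_left subset_rfl
      (Nat.zero_le δ) le_rfl
  | insert i I hi ih =>
    rw [Finset.sum_insert hi, Finset.set_biUnion_insert]
    exact (h i (Finset.mem_insert_self i I)).union
      (ih fun j hj => h j (Finset.mem_insert_of_mem hj))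

/-- A finite family of polynomials of equal cost. -/
theorem Gen.biUnion_const {ι : Type*} (I : Finset ι) {e N : ℕ} {X : ι → Set (MvPolynomial V F)}
    (h : ∀ i ∈ I, Gen S δ e (X i)) (hN : I.card ≤ N) : Gen S δ (N * e) (⋃ i ∈ I, X i) := by
  refine (Gen.biUnion I h).mono Set.subset_union_left subset_rfl le_rfl ?_
  simpa using Nat.mul_le_mul_right e hN

/-- One layer of scalar multiples and one sum gate: two edges for each multiple and one for each
summand, hence the factor 3. -/
theorem Gen.of_mem_span {ι : Type*} (I : Finset ι) {f : ι → MvPolynomial V F} {N : ℕ}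
    (hf : ∀ i ∈ I, f i ∈ S ∪ constSet F V) (hN : I.card ≤ N) {p : MvPolynomial V F}
    (hp : p ∈ Submodule.span F (f '' I)) : Gen S 2 (3 * N) {p} := by
  classical
  obtain ⟨c, rfl⟩ := (Submodule.mem_span_image_finset_iff_exists_fun F).1 hp
  have hN' : I.attach.card ≤ N := by simpa using hN
  have h1 : Gen S 1 (N * 2) (⋃ i ∈ I.attach, {MvPolynomial.C (c i) * f i}) := by
    refine Gen.biUnion_const I.attach (fun i _ => ?_) hN'
    simpa using Gen.prod (S := S) (l := {MvPolynomial.C (c i), f i}) (by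
      simp only [Multiset.insert_eq_cons, Multiset.mem_cons, Multiset.mem_singleton]
      rintro p (rfl | rfl)
      · exact Or.inr ⟨_, rfl⟩
      · exact hf i i.2)
  have h2 := Gen.sum (S := ⋃ i ∈ I.attach, {MvPolynomial.C (c i) * f i})
    (l := I.attach.val.map fun i => MvPolynomial.C (c i) * f i) (by
      simp only [Multiset.mem_map, Finset.mem_val]
      rintro p ⟨i, hi, rfl⟩
      exact Or.inl (Set.mem_biUnion hi rfl))
  have h3 : (I.attach.val.map fun i => MvPolynomial.C (c i) * f i).sum
      = ∑ i ∈ I.attach, c i • f i :=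
    Finset.sum_congr rfl fun i _ => (MvPolynomial.smul_eq_C_mul _ _).symm
  rw [h3, Multiset.card_map] at h2
  have h4 : Multiset.card I.attach.val ≤ N := hN'
  exact (h1.comp h2).mono Set.subset_union_left subset_rfl le_rfl (by omega)

theorem Gen.exists_circuit {p : MvPolynomial V F}
    (h : Gen (Set.range MvPolynomial.X) δ e {p}) :
    ∃ C : Circuit F V, C.poly = p ∧ C.depth ≤ δ ∧ C.size ≤ e := by
  obtain ⟨W, e', h1, h2, h3⟩ := h (leafSet F V) 0
    (by rintro _ ⟨c, rfl⟩; exact ⟨0, le_rfl, Or.inr ⟨c, rfl⟩, rfl⟩)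
    (by rintro _ ⟨c, rfl⟩; exact ⟨0, le_rfl, Or.inl ⟨c, rfl⟩, rfl⟩)
  obtain ⟨t, ht, hW⟩ := h3 p rfl
  obtain ⟨C, hC, hC'⟩ := h2.exists_circuit {(p, t)} (Set.finite_singleton _) (by simpa using hW)
  obtain ⟨a, ha, ha'⟩ := hC' _ rfl
  have hm : ∀ b, ({ C with out := a } : Circuit F V).gate b = (C.gate b).mapNode id := fun b => by
    cases hb : C.gate b <;> simp [Gate.mapNode]
  exact ⟨{ C with out := a },
    (Circuit.nodePoly_map (C := C) (C' := { C with out := a }) (f := id) hm a).trans ha,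
    (Circuit.nodeDepth_map (C := C) (C' := { C with out := a }) (f := id) hm a).trans_le
      (ha'.trans (ht.trans_eq (zero_add δ))), hC.trans_le h1⟩

end Calculus

/-! ## Interpolation -/

section Interpolation

variable {F R : Type*} [Field F] [CommRing R] [Algebra F R]

/-- The coefficients of a polynomial of degree less than `N` are linear combinations of its values
at `0, …, N - 1`. -/
theorem Polynomial.coeff_mem_span_eval [CharZero F] (f : Polynomial R) {N : ℕ} (hf : f.natDegree < N) (j : ℕ) :
    f.coeff j ∈ Submodule.span F
      ((fun η : ℕ => f.eval (algebraMap F R η)) '' (Finset.range N : Set ℕ)) := by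
  classical
  have hinj : Set.InjOn (fun η : ℕ => (η : F)) (Finset.range N : Set ℕ) :=
    Nat.cast_injective.injOn
  have key : f = ∑ η ∈ Finset.range N, Polynomial.C (f.eval (algebraMap F R η)) *
      (Lagrange.basis (Finset.range N) (fun η : ℕ => (η : F)) η).map (algebraMap F R) := by
    -- Lagrange interpolation is available over the field F only; it is applied to the monomials and
    -- carried to the coefficient ring R by linearity.
    have hpow : ∀ i < N, (Polynomial.X : Polynomial F) ^ i = ∑ η ∈ Finset.range N,
        Polynomial.C ((η : F) ^ i) *
          Lagrange.basis (Finset.range N) (fun η : ℕ => (η : F)) η := by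
      intro i hi
      have := Lagrange.eq_interpolate (s := Finset.range N) (v := fun η : ℕ => (η : F)) hinj
        (f := (Polynomial.X : Polynomial F) ^ i) (by simpa using hi)
      rw [Lagrange.interpolate_apply] at this
      simpa using this
    conv_lhs => rw [f.as_sum_range' N hf]
    have : ∀ η : ℕ, Polynomial.C (f.eval (algebraMap F R η)) =
        ∑ i ∈ Finset.range N, Polynomial.C (f.coeff i) *
          Polynomial.C (algebraMap F R ((η : F) ^ i)) := by
      intro η
      rw [Polynomial.eval_eq_sum_range' hf]
      simp
    simp_rw [this, Finset.sum_mul]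
    rw [Finset.sum_comm]
    refine Finset.sum_congr rfl fun i hi => ?_
    have h := congrArg (Polynomial.map (algebraMap F R)) (hpow i (Finset.mem_range.1 hi))
    rw [Polynomial.map_sum] at h
    simp only [Polynomial.map_mul, Polynomial.map_pow, Polynomial.map_X, Polynomial.map_C] at h
    rw [← Polynomial.C_mul_X_pow_eq_monomial, h, Finset.mul_sum]
    simp only [map_pow, mul_assoc]
  rw [key, Polynomial.finsetSum_coeff]
  refine Submodule.sum_mem _ fun η hη => ?_
  rw [Polynomial.coeff_C_mul, Polynomial.coeff_map, mul_comm, ← Algebra.smul_def, ← key]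
  exact Submodule.smul_mem _ _ (Submodule.subset_span ⟨η, hη, rfl⟩)

/-- The truncation of a polynomial to degree less than `K`. -/
noncomputable def Polynomial.cut (K : ℕ) (f : Polynomial R) : Polynomial R :=
  ∑ i ∈ Finset.range K, Polynomial.C (f.coeff i) * Polynomial.X ^ i

theorem Polynomial.coeff_cut (K : ℕ) (f : Polynomial R) (i : ℕ) :
    (f.cut K).coeff i = if i < K then f.coeff i else 0 := by
  simp [Polynomial.cut, Polynomial.finsetSum_coeff, Polynomial.coeff_X_pow]

theorem Polynomial.natDegree_cut_le (K : ℕ) (f : Polynomial R) :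
    (f.cut K).natDegree ≤ K - 1 := by
  rw [Polynomial.natDegree_le_iff_coeff_eq_zero]
  intro i hi
  rw [Polynomial.coeff_cut, if_neg (by omega)]

theorem Polynomial.X_pow_dvd_sub_cut (K : ℕ) (f : Polynomial R) :
    Polynomial.X ^ K ∣ f - f.cut K := by
  rw [Polynomial.X_pow_dvd_iff]
  intro i hi
  rw [Polynomial.coeff_sub, Polynomial.coeff_cut, if_pos hi, sub_self]

theorem Polynomial.coeff_eq_of_X_pow_dvd_sub {K : ℕ} {f g : Polynomial R}
    (h : Polynomial.X ^ K ∣ f - g) {i : ℕ} (hi : i < K) : f.coeff i = g.coeff i := by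
  have := Polynomial.X_pow_dvd_iff.1 h i hi
  rwa [Polynomial.coeff_sub, sub_eq_zero] at this

theorem Polynomial.eval_cut_mem_span (K : ℕ) (f : Polynomial R) (η : F) :
    (f.cut K).eval (algebraMap F R η) ∈
      Submodule.span F (f.coeff '' (Finset.range K : Set ℕ)) := by
  rw [Polynomial.cut, Polynomial.eval_finsetSum]
  refine Submodule.sum_mem _ fun i hi => ?_
  simp only [Polynomial.eval_mul, Polynomial.eval_C, Polynomial.eval_pow, Polynomial.eval_X,
    ← map_pow]
  rw [mul_comm, ← Algebra.smul_def]
  exact Submodule.smul_mem _ _ (Submodule.subset_span ⟨i, hi, rfl⟩)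

theorem Polynomial.X_pow_dvd_prod_sub_prod_cut (K : ℕ) (l : Multiset (Polynomial R)) :
    Polynomial.X ^ K ∣ l.prod - (l.map (Polynomial.cut K)).prod := by
  induction l using Multiset.induction_on with
  | empty => simp
  | cons f l ih =>
    rw [Multiset.prod_cons, Multiset.map_cons, Multiset.prod_cons]
    have : f * l.prod - f.cut K * (l.map (Polynomial.cut K)).prod =
        (f - f.cut K) * l.prod + f.cut K * (l.prod - (l.map (Polynomial.cut K)).prod) := by ring
    rw [this]
    exact dvd_add ((Polynomial.X_pow_dvd_sub_cut K f).mul_right _) (ih.mul_left _)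

end Interpolation

/-! ## Truncated substitution into a circuit -/

section Substitution

variable {F V V' : Type*}

/-- A node is live if it is the output or feeds a gate. -/
def Circuit.Live (D : Circuit F V') (a : D.Node) : Prop :=
  a = D.out ∨ ∃ b, a ∈ (D.gate b).inputs

/-- Size counts edges, so it does not bound the number of isolated leaves. Apart from the output, a
live node is the source of an edge. -/
theorem Circuit.exists_live_finset (D : Circuit F V') :
    ∃ I : Finset D.Node, I.card ≤ D.size + 1 ∧ ∀ a, D.Live a → a ∈ I := by
  classical
  let := D.fintypeNode
  refine ⟨insert D.out (Finset.univ.biUnion fun b => (D.gate b).inputs.toFinset), ?_, ?_⟩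
  · refine (Finset.card_insert_le _ _).trans (Nat.succ_le_succ ?_)
    refine Finset.card_biUnion_le.trans (Finset.sum_le_sum fun b _ => ?_)
    exact Multiset.toFinset_card_le _
  · rintro a (rfl | ⟨b, hb⟩)
    · exact Finset.mem_insert_self _ _
    · exact Finset.mem_insert_of_mem (Finset.mem_biUnion.2
        ⟨b, Finset.mem_univ _, Multiset.mem_toFinset.2 hb⟩)

/-- The variables that label a live leaf. -/
def Circuit.Uses (D : Circuit F V') (v : V') : Prop :=
  ∃ a, D.Live a ∧ D.gate a = .var v

theorem Circuit.exists_uses_finset (D : Circuit F V') :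
    ∃ I : Finset V', I.card ≤ D.size + 1 ∧ ∀ v, D.Uses v → v ∈ I := by
  classical
  obtain ⟨I, hI, hI'⟩ := D.exists_live_finset
  refine ⟨I.biUnion fun a => match D.gate a with
    | .var v => {v}
    | _ => ∅, ?_, ?_⟩
  · refine le_trans (Finset.card_biUnion_le_card_mul _ _ 1 fun a _ => ?_) (by simpa using hI)
    cases D.gate a <;> simp
  · rintro v ⟨a, ha, hv⟩
    exact Finset.mem_biUnion.2 ⟨a, hI' a ha, by rw [hv]; exact Finset.mem_singleton_self v⟩

variable [Field F] {S : Set (MvPolynomial V F)}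

theorem Gen.coeff_sum {l : Multiset (Polynomial (MvPolynomial V F))} {K : ℕ}
    (h : ∀ f ∈ l, ∀ i < K, f.coeff i ∈ S) :
    Gen S 1 (K * l.card) {q | ∃ i < K, q = l.sum.coeff i} := by
  refine (Gen.biUnion_const (Finset.range K) (X := fun i => {l.sum.coeff i}) (e := l.card)
    (fun i hi => ?_) (Finset.card_range K).le).mono Set.subset_union_left ?_ le_rfl le_rfl
  · have := Gen.sum (S := S) (l := l.map fun f => f.coeff i) (by
      simp only [Multiset.mem_map]
      rintro p ⟨f, hf, rfl⟩
      exact Or.inl (h f hf i (Finset.mem_range.1 hi)))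
    rw [Multiset.card_map] at this
    convert this
    exact map_multiset_sum (Polynomial.lcoeff (MvPolynomial V F) i) l
  · rintro q ⟨i, hi, rfl⟩
    exact Set.mem_biUnion (Finset.mem_range.2 hi) rfl

theorem Gen.eval_cut {l : Finset (Polynomial (MvPolynomial V F))} {K N m : ℕ} (hl : l.card ≤ m)
    (h : ∀ f ∈ l, ∀ i < K, f.coeff i ∈ S ∪ constSet F V) :
    Gen S 2 (m * (N * (3 * K)))
      {q | ∃ f ∈ l, ∃ η < N, q = (f.cut K).eval (algebraMap F _ (η : F))} := by
  refine (Gen.biUnion_const l (fun f hf => Gen.biUnion_const (Finset.range N)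
    (X := fun η => {(f.cut K).eval (algebraMap F _ (η : F))}) (fun η _ => ?_)
    (Finset.card_range N).le) hl).mono Set.subset_union_left ?_ le_rfl le_rfl
  · exact Gen.of_mem_span (Finset.range K) (fun i hi => h f hf i (Finset.mem_range.1 hi))
      (Finset.card_range K).le (f.eval_cut_mem_span K (η : F))
  · rintro q ⟨f, hf, η, hη, rfl⟩
    exact Set.mem_biUnion hf (Set.mem_biUnion (Finset.mem_coe.2 (Finset.mem_range.2 hη)) rfl)

theorem Gen.coeff_of_eval [CharZero F] (f : Polynomial (MvPolynomial V F)) {K N : ℕ}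
    (hf : f.natDegree < N) :
    Gen {q | ∃ η < N, q = f.eval (algebraMap F _ ((η : ℕ) : F))} 2 (K * (3 * N))
      {q | ∃ i < K, q = f.coeff i} := by
  refine (Gen.biUnion_const (Finset.range K) (X := fun i => {f.coeff i}) (e := 3 * N)
    (fun i _ => ?_) (Finset.card_range K).le).mono Set.subset_union_left ?_ le_rfl le_rfl
  · exact Gen.of_mem_span (Finset.range N)
      (S := {q | ∃ η < N, q = f.eval (algebraMap F _ ((η : ℕ) : F))})
      (f := fun η : ℕ => f.eval (algebraMap F (MvPolynomial V F) η))
      (fun η hη => Or.inl ⟨η, Finset.mem_range.1 hη, rfl⟩)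
      (Finset.card_range N).le (Polynomial.coeff_mem_span_eval f hf i)
  · rintro q ⟨i, hi, rfl⟩
    exact Set.mem_biUnion (Finset.mem_coe.2 (Finset.mem_range.2 hi)) rfl

theorem Gen.eval_prod_cut (l : Multiset (Polynomial (MvPolynomial V F))) (K N : ℕ) :
    Gen {q | ∃ f ∈ l, ∃ η < N, q = (f.cut K).eval (algebraMap F _ ((η : ℕ) : F))} 1 (N * l.card)
      {q | ∃ η < N, q = (l.map (Polynomial.cut K)).prod.eval (algebraMap F _ ((η : ℕ) : F))} := by
  refine (Gen.biUnion_const (Finset.range N) (e := l.card)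
    (X := fun η => {((l.map (Polynomial.cut K)).prod).eval (algebraMap F _ (η : F))})
    (fun η hη => ?_) (Finset.card_range _).le).mono Set.subset_union_left ?_ le_rfl le_rfl
  · have := Gen.prod
      (S := {q | ∃ f ∈ l, ∃ η < N, q = (f.cut K).eval (algebraMap F _ ((η : ℕ) : F))})
      (l := l.map fun f => (f.cut K).eval (algebraMap F (MvPolynomial V F) (η : F))) (by
      simp only [Multiset.mem_map]
      rintro p ⟨f, hf, rfl⟩
      exact Or.inl ⟨f, hf, η, Finset.mem_range.1 hη, rfl⟩)
    rw [Multiset.card_map] at this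
    rwa [Polynomial.eval_multiset_prod, Multiset.map_map]
  · rintro q ⟨η, hη, rfl⟩
    exact Set.mem_biUnion (Finset.mem_coe.2 (Finset.mem_range.2 hη)) rfl

theorem Polynomial.natDegree_prod_cut_lt {R : Type*} [CommRing R] {l : Multiset (Polynomial R)}
    {K : ℕ} (hK : 0 < K) (hl : 0 < l.card) :
    (l.map (Polynomial.cut K)).prod.natDegree < l.card * K := by
  refine lt_of_le_of_lt (Polynomial.natDegree_multiset_prod_le _) ?_
  refine lt_of_le_of_lt (Multiset.sum_le_card_nsmul _ (K - 1) ?_) ?_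
  · simp only [Multiset.mem_map]
    rintro _ ⟨_, ⟨f, _, rfl⟩, rfl⟩
    exact f.natDegree_cut_le K
  · simp only [Multiset.card_map, smul_eq_mul]
    exact (Nat.mul_lt_mul_left hl).2 (by omega)

/-- The coefficients below K of the product do not change when the factors are truncated, and the
truncated product has degree below `l.card * K`. Evaluate the truncated factors at that many points,
multiply pointwise and interpolate: depth 2 + 1 + 2, independently of the number of factors. -/
theorem Gen.coeff_prod [CharZero F] {l : Multiset (Polynomial (MvPolynomial V F))} {K : ℕ}
    (h : ∀ f ∈ l, ∀ i < K, f.coeff i ∈ S) :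
    Gen S 5 (7 * l.card ^ 2 * K ^ 2) {q | ∃ i < K, q = l.prod.coeff i} := by
  classical
  rcases l.empty_or_exists_mem with rfl | ⟨f₀, hf₀⟩
  · refine (Gen.base ?_).mono Set.subset_union_left subset_rfl (Nat.zero_le _) (Nat.zero_le _)
    rintro q ⟨i, -, rfl⟩
    refine Or.inr ⟨if i = 0 then 1 else 0, ?_⟩
    simp only [Multiset.prod_zero, Polynomial.coeff_one]
    split_ifs <;> simp
  rcases Nat.eq_zero_or_pos K with rfl | hK
  · refine (Gen.base ?_).mono Set.subset_union_left subset_rfl (Nat.zero_le _) (Nat.zero_le _)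
    rintro q ⟨i, hi, rfl⟩
    exact absurd hi (Nat.not_lt_zero i)
  have hm : 0 < l.card := Multiset.card_pos_iff_exists_mem.2 ⟨f₀, hf₀⟩
  have h1 := Gen.eval_cut (l := l.toFinset) (N := l.card * K) (K := K) (S := S)
    (Multiset.toFinset_card_le l) fun f hf i hi => Or.inl (h f (Multiset.mem_toFinset.1 hf) i hi)
  simp only [Multiset.mem_toFinset] at h1
  have h3 := Gen.coeff_of_eval (K := K) _ (Polynomial.natDegree_prod_cut_lt hK hm)
  refine ((h1.comp (Gen.eval_prod_cut l K (l.card * K))).comp h3).mono Set.subset_union_left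
    ?_ le_rfl ?_
  · rintro q ⟨i, hi, rfl⟩
    exact ⟨i, hi, Polynomial.coeff_eq_of_X_pow_dvd_sub
      (Polynomial.X_pow_dvd_prod_sub_prod_cut K l) hi⟩
  · have e1 : l.card * (l.card * K * (3 * K)) = 3 * (l.card ^ 2 * K ^ 2) := by ring
    have e2 : l.card * K * l.card ≤ l.card ^ 2 * K ^ 2 := by
      calc l.card * K * l.card = l.card ^ 2 * K := by ring
        _ ≤ l.card ^ 2 * K ^ 2 := Nat.mul_le_mul_left _ (Nat.le_self_pow two_ne_zero K)
    have e3 : K * (3 * (l.card * K)) ≤ 3 * (l.card ^ 2 * K ^ 2) := by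
      calc K * (3 * (l.card * K)) = 3 * (l.card * K ^ 2) := by ring
        _ ≤ 3 * (l.card ^ 2 * K ^ 2) := by
          gcongr
          exact Nat.le_self_pow two_ne_zero l.card
    rw [e1]
    linarith

/-- A sum gate is cheaper; its cost is rounded up to that of a product gate so that both kinds of
gate are counted alike. -/
theorem Gen.coeff_gate {l : Multiset (Polynomial (MvPolynomial V F))} {K : ℕ}
    (h : ∀ f ∈ l, ∀ i < K, f.coeff i ∈ S) :
    Gen S 5 (7 * l.card ^ 2 * K ^ 2) {q | ∃ i < K, q = l.sum.coeff i} := by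
  refine (Gen.coeff_sum h).mono Set.subset_union_left subset_rfl (by omega) ?_
  calc K * l.card = l.card * K := mul_comm _ _
    _ ≤ l.card ^ 2 * K ^ 2 :=
      Nat.mul_le_mul (Nat.le_self_pow two_ne_zero _) (Nat.le_self_pow two_ne_zero _)
    _ ≤ 7 * l.card ^ 2 * K ^ 2 := by nlinarith [Nat.zero_le (l.card ^ 2 * K ^ 2)]

/-- Substitute polynomials in a new variable into a circuit, truncating at each gate. -/
theorem Gen.coeff_aeval [CharZero F] (D : Circuit F V') (φ : V' → Polynomial (MvPolynomial V F)) (K : ℕ)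
    (hS : ∀ v, D.Uses v → ∀ i < K, (φ v).coeff i ∈ S ∪ constSet F V) :
    Gen S (5 * D.depth) (7 * D.size ^ 2 * K ^ 2)
      {q | ∃ i < K, q = (MvPolynomial.aeval φ D.poly).coeff i} := by
  classical
  let := D.fintypeNode
  set cost : D.Node → ℕ := fun a => 7 * (D.gate a).inputs.card ^ 2 * K ^ 2 with hcost
  set X : ℕ → Set (MvPolynomial V F) := fun t =>
    {q | ∃ a, D.Live a ∧ D.nodeDepth a ≤ t ∧ ∃ i < K,
      q = (MvPolynomial.aeval φ (D.nodePoly a)).coeff i} with hX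
  have hgate : ∀ t a, D.nodeDepth a = t + 1 →
      Gen (X t) 5 (cost a) {q | ∃ i < K, q = (MvPolynomial.aeval φ (D.nodePoly a)).coeff i} := by
    intro t a ha
    have hin : ∀ b ∈ (D.gate a).inputs, D.Live b := fun b hb => Or.inr ⟨a, hb⟩
    rw [D.nodeDepth_eq] at ha
    rw [D.nodePoly_eq, hcost]
    cases hg : D.gate a with
    | var v => simp [hg] at ha
    | const c => simp [hg] at ha
    | add l =>
      simp only [hg, add_left_inj] at ha
      simp only [hg, Gate.inputs] at hin
      have := Gen.coeff_gate (S := X t) (K := K)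
        (l := l.map fun b => MvPolynomial.aeval φ (D.nodePoly b)) (by
        simp only [Multiset.mem_map]
        rintro f ⟨b, hb, rfl⟩ i hi
        exact ⟨b, hin b hb, ha ▸ Multiset.le_sup (Multiset.mem_map_of_mem _ hb), i, hi, rfl⟩)
      simpa only [map_multiset_sum, Multiset.map_map, Multiset.card_map, hg, Gate.inputs]
        using! this
    | mul l =>
      simp only [hg, add_left_inj] at ha
      simp only [hg, Gate.inputs] at hin
      have := Gen.coeff_prod (S := X t) (K := K)
        (l := l.map fun b => MvPolynomial.aeval φ (D.nodePoly b)) (by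
        simp only [Multiset.mem_map]
        rintro f ⟨b, hb, rfl⟩ i hi
        exact ⟨b, hin b hb, ha ▸ Multiset.le_sup (Multiset.mem_map_of_mem _ hb), i, hi, rfl⟩)
      simpa only [map_multiset_prod, Multiset.map_map, Multiset.card_map, hg, Gate.inputs]
        using! this
  -- Induction on the depth of nodes. Coefficients found at lower levels are kept, and each gate is
  -- paid for once, at its own level.
  have hlevel : ∀ t, Gen S (5 * t) (∑ a ∈ Finset.univ.filter (D.nodeDepth · ≤ t), cost a) (X t) := by
    intro t
    induction t with
    | zero =>
      refine (Gen.base ?_).mono Set.subset_union_left subset_rfl (Nat.zero_le _) (Nat.zero_le _)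
      rintro q ⟨a, hl, ha, i, hi, rfl⟩
      rw [D.nodeDepth_eq] at ha
      rw [D.nodePoly_eq]
      cases hg : D.gate a with
      | var v =>
        simp only [MvPolynomial.aeval_X]
        exact hS v ⟨a, hl, hg⟩ i hi
      | const c =>
        refine Or.inr ⟨if i = 0 then c else 0, ?_⟩
        simp only [MvPolynomial.aeval_C]
        rw [Polynomial.algebraMap_apply, Polynomial.coeff_C]
        split_ifs <;> simp [MvPolynomial.algebraMap_eq]
      | add l => simp [hg] at ha
      | mul l => simp [hg] at ha
    | succ t ih =>
      have h1 := Gen.biUnion (Finset.univ.filter (D.nodeDepth · = t + 1))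
        fun a ha => hgate t a (Finset.mem_filter.1 ha).2
      refine (ih.comp h1.keep).mono Set.subset_union_left ?_ (by omega) ?_
      · rintro q ⟨a, hl, ha, i, hi, rfl⟩
        rcases Nat.lt_or_ge (D.nodeDepth a) (t + 1) with h | h
        · exact Or.inr ⟨a, hl, Nat.lt_succ_iff.1 h, i, hi, rfl⟩
        · exact Or.inl (Set.mem_biUnion (x := a) (by simpa using le_antisymm ha h) ⟨i, hi, rfl⟩)
      · rw [← Finset.sum_union]
        · refine Finset.sum_le_sum_of_subset fun a => ?_
          simp only [Finset.mem_union, Finset.mem_filter, Finset.mem_univ, true_and]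
          omega
        · rw [Finset.disjoint_filter]
          intro a _ h
          omega
  refine (hlevel D.depth).mono Set.subset_union_left ?_ le_rfl ?_
  · rintro q ⟨i, hi, rfl⟩
    exact ⟨D.out, Or.inl rfl, le_rfl, i, hi, rfl⟩
  · calc ∑ a ∈ Finset.univ.filter (D.nodeDepth · ≤ D.depth), cost a ≤ ∑ a, cost a :=
        Finset.sum_le_sum_of_subset (Finset.filter_subset _ _)
      _ = 7 * K ^ 2 * ∑ a, (D.gate a).inputs.card ^ 2 := by
        rw [Finset.mul_sum]
        exact Finset.sum_congr rfl fun a _ => by rw [hcost]; ring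
      _ ≤ 7 * K ^ 2 * (∑ a, (D.gate a).inputs.card) ^ 2 := by
        gcongr
        exact Finset.sum_sq_le_sq_sum_of_nonneg fun _ _ => Nat.zero_le _
      _ = 7 * D.size ^ 2 * K ^ 2 := by rw [Circuit.size]; ring

end Substitution

/-! ## Lagrange inversion for a nilpotent perturbation -/

section Lagrange

open PowerSeries

variable {F Q : Type*} [Field F] [CharZero F] [CommRing Q] [Algebra F Q]

/-- If `G ∈ (t, z²)` and `t ^ k = 0`, then the low coefficients of `H * G ^ m` vanish. -/
theorem PowerSeries.coeff_mul_pow_eq_zero {Q : Type*} [CommRing Q] {t : Q} {k : ℕ}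
    (ht : t ^ k = 0) {G a b : PowerSeries Q} (hG : G = C t * a + X ^ 2 * b)
    (H : PowerSeries Q) {n m : ℕ} (h : n + 2 * k ≤ 2 * m + 1) : coeff n (H * G ^ m) = 0 := by
  rw [hG, add_pow, Finset.mul_sum, map_sum]
  refine Finset.sum_eq_zero fun j hj => ?_
  have hj' : j ≤ m := Nat.lt_succ_iff.1 (Finset.mem_range.1 hj)
  -- In the binomial expansion, terms with at least k factors t vanish by nilpotency; every other
  -- term is divisible by X to the power 2(m - j) ≥ 2(m - k + 1) > n.
  rcases Nat.lt_or_ge j k with hjk | hjk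
  · have : H * ((C t * a) ^ j * (X ^ 2 * b) ^ (m - j) * (m.choose j : PowerSeries Q)) =
        X ^ (2 * (m - j)) * (H * (C t * a) ^ j * b ^ (m - j) * (m.choose j : PowerSeries Q)) := by
      rw [pow_mul]; ring
    rw [this, coeff_X_pow_mul', if_neg (by omega)]
  · have : (C t * a) ^ j = 0 := by
      rw [mul_pow, ← map_pow, pow_eq_zero_of_le hjk ht, map_zero, zero_mul]
    rw [this, zero_mul, zero_mul, mul_zero, map_zero]

/-- The rule (G^(m+1))' = (m+1) G' G^m, read off coefficientwise. -/
theorem PowerSeries.succ_mul_coeff_derivative_mul_pow {Q : Type*} [CommRing Q]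
    (G : PowerSeries Q) (m n : ℕ) :
    ((m : Q) + 1) * coeff n (derivative Q G * G ^ m) = (n + 1) * coeff (n + 1) (G ^ (m + 1)) := by
  have h1 : derivative Q (G ^ (m + 1)) = ((m : PowerSeries Q) + 1) * (derivative Q G * G ^ m) := by
    rw [Derivation.leibniz_pow]
    simp only [Nat.add_sub_cancel, smul_eq_mul, nsmul_eq_mul]
    push_cast
    ring
  have h2 := congrArg (coeff n) h1
  rw [coeff_derivative] at h2
  have h3 : ((m : PowerSeries Q) + 1) = C ((m : Q) + 1) := by simp
  rw [h3, coeff_C_mul] at h2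
  rw [← h2, mul_comm]

/-- A root `u` of `u = G(u)`, for `G ∈ (t, z²)` and `t` nilpotent, is a combination of
coefficients of powers of `G`. -/
theorem eq_sum_coeff_pow_of_eval_eq {t : Q} {k : ℕ} (ht : t ^ k = 0) {G : Polynomial Q} {u : Q}
    (h0 : t ∣ G.coeff 0) (h1 : t ∣ G.coeff 1) (hu : t ∣ u) (hroot : G.eval u = u) :
    u = ∑ m ∈ Finset.range (2 * k), ((m : F) + 1)⁻¹ • (G ^ (m + 1)).coeff m := by
  rcases Nat.eq_zero_or_pos k with rfl | hk
  · have : Subsingleton Q := subsingleton_of_zero_eq_one (by simpa using ht.symm)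
    exact Subsingleton.elim _ _
  obtain ⟨M, hM⟩ : ∃ M, 2 * k = M + 1 := ⟨2 * k - 1, by omega⟩
  have hunit : ∀ m : ℕ, IsUnit ((m : Q) + 1) := fun m => by
    have : ((m : Q) + 1) = algebraMap F Q ((m : F) + 1) := by simp
    rw [this]
    exact (IsUnit.mk0 _ (Nat.cast_add_one_ne_zero m)).map _
  set g : PowerSeries Q := (G : PowerSeries Q) with hg
  obtain ⟨a, b, hab⟩ : ∃ a b : PowerSeries Q, g = C t * a + X ^ 2 * b := by
    obtain ⟨c0, hc0⟩ := h0
    obtain ⟨c1, hc1⟩ := h1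
    refine ⟨C c0 + C c1 * X, (G.divX.divX : Polynomial Q), ?_⟩
    have e1 := G.divX_mul_X_add
    have e2 := G.divX.divX_mul_X_add
    rw [Polynomial.coeff_divX, zero_add, hc1] at e2
    rw [hc0, ← e2] at e1
    conv_lhs => rw [hg, ← e1]
    simp only [Polynomial.coe_add, Polynomial.coe_mul, Polynomial.coe_C, Polynomial.coe_X,
      map_mul]
    ring
  have hvan : ∀ (H : PowerSeries Q) (n m : ℕ), n + 2 * k ≤ 2 * m + 1 → coeff n (H * g ^ m) = 0 :=
    fun H n m h => coeff_mul_pow_eq_zero ht hab H h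
  -- Formally L(H) is the residue of H / (z - g), with 1 / (z - g) expanded as ∑ g^m / z^(m+1); the
  -- terms with m ≥ 2k - 1 vanish by `hvan`. The plan is to evaluate L(z(1 - g')) both as the root u
  -- and as the sum of coefficients.
  set L : PowerSeries Q → Q := fun H => ∑ m ∈ Finset.range (M + 1), coeff m (H * g ^ m) with hL
  -- Telescoping; the term left over at the top is zero by `hvan`.
  have hLmul : ∀ H, L (H * (X - g)) = 0 := by
    intro H
    have e : ∀ m, coeff m (H * (X - g) * g ^ m) =
        coeff m (X * (H * g ^ m)) - coeff m (H * g ^ (m + 1)) := fun m => by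
      rw [← map_sub]; congr 1; ring
    simp only [hL, e, Finset.sum_sub_distrib]
    rw [Finset.sum_range_succ', Finset.sum_range_succ _ M]
    simp only [coeff_succ_X_mul, coeff_zero_X_mul]
    rw [hvan H M (M + 1) (by omega)]
    ring
  set d := derivative Q g with hd
  -- The coefficient of z^m in g' g^m is that of z^(m+1) in g^(m+1), so this also telescopes. It is
  -- the residue count of a single root.
  have hL1 : L (1 - d) = 1 := by
    have e : ∀ m, coeff m ((1 - d) * g ^ m) = coeff m (g ^ m) - coeff (m + 1) (g ^ (m + 1)) := by
      intro m
      rw [sub_mul, one_mul, map_sub]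
      congr 1
      exact (hunit m).mul_left_cancel (succ_mul_coeff_derivative_mul_pow g m m)
    simp only [hL, e, Finset.sum_range_sub']
    have := hvan 1 (M + 1) (M + 1) (by omega)
    rw [one_mul] at this
    rw [this]
    simp
  have hLX : L (X * (1 - d)) =
      ∑ m ∈ Finset.range (M + 1), ((m : F) + 1)⁻¹ • (G ^ (m + 1)).coeff m := by
    have hc : ∀ m, (G ^ (m + 1)).coeff m = coeff m (g ^ (m + 1)) := fun m => by
      rw [hg, ← Polynomial.coe_pow, Polynomial.coeff_coe]
    have hder : ∀ m : ℕ, coeff m (d * g ^ (m + 1)) =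
        coeff (m + 1) (g ^ (m + 2)) - ((m + 1 : ℕ) + 1 : F)⁻¹ • coeff (m + 1) (g ^ (m + 2)) := by
      intro m
      have h := succ_mul_coeff_derivative_mul_pow g (m + 1) m
      refine (hunit (m + 1)).mul_left_cancel (h.trans ?_)
      rw [mul_sub, Algebra.smul_def, ← mul_assoc]
      have : (((m + 1 : ℕ) : Q) + 1) * algebraMap F Q (((m + 1 : ℕ) : F) + 1)⁻¹ = 1 := by
        have e : (((m + 1 : ℕ) : Q) + 1) = algebraMap F Q (((m + 1 : ℕ) : F) + 1) := by simp
        rw [e, ← map_mul, mul_inv_cancel₀ (Nat.cast_add_one_ne_zero (m + 1)), map_one]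
      rw [this]
      push_cast
      ring
    have e : ∀ m, coeff (m + 1) (X * (1 - d) * g ^ (m + 1)) = coeff m (g ^ (m + 1)) -
        coeff (m + 1) (g ^ (m + 2)) +
          ((m + 1 : ℕ) + 1 : F)⁻¹ • coeff (m + 1) (g ^ (m + 2)) := by
      intro m
      rw [mul_assoc, coeff_succ_X_mul, sub_mul, one_mul, map_sub, hder]
      ring
    have e0 : coeff 0 (X * (1 - d) * g ^ 0) = 0 := by
      rw [mul_assoc, coeff_zero_X_mul]
    have hlast := hvan 1 M (M + 1) (by omega)
    rw [one_mul] at hlast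
    simp only [hL, hc]
    rw [Finset.sum_range_succ', e0, Finset.sum_range_succ']
    simp only [e, Finset.sum_add_distrib]
    rw [Finset.sum_range_sub' (fun m => coeff m (g ^ (m + 1))), hlast]
    rw [sub_zero, add_zero, add_comm]
    simp
  -- From G - u = (z - u) B follows z - g = (z - u)(1 - B). The constant term of B is a multiple of
  -- t, hence nilpotent, so 1 - B is a unit. Thus L kills all multiples of z - u, which gives u =
  -- L(z(1 - g')).
  obtain ⟨B, hB⟩ : (Polynomial.X - Polynomial.C u) ∣ G - Polynomial.C u := by
    rw [Polynomial.dvd_iff_isRoot]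
    simp [hroot]
  have hB0 : B.coeff 0 = G.coeff 1 + u * B.coeff 1 := by
    have := congrArg (fun p => Polynomial.coeff p 1) hB
    simp only [Polynomial.coeff_sub, sub_mul, Polynomial.coeff_X_mul, Polynomial.coeff_C_mul,
      Polynomial.coeff_C_succ] at this
    linear_combination -this
  have hV : IsUnit (1 - (B : PowerSeries Q)) := by
    rw [PowerSeries.isUnit_iff_constantCoeff]
    rw [map_sub, map_one, ← coeff_zero_eq_constantCoeff_apply, Polynomial.coeff_coe, hB0]
    refine IsNilpotent.isUnit_one_sub ⟨k, ?_⟩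
    obtain ⟨c, hc⟩ := dvd_add h1 (hu.mul_right (B.coeff 1))
    rw [hc, mul_pow, ht, zero_mul]
  obtain ⟨W, hW⟩ := hV.exists_right_inv
  have hfac : X - g = (X - C u) * (1 - (B : PowerSeries Q)) := by
    have := congrArg (fun p : Polynomial Q => (p : PowerSeries Q)) hB
    simp only [Polynomial.coe_sub, Polynomial.coe_mul, Polynomial.coe_C, Polynomial.coe_X] at this
    rw [hg]
    linear_combination -this
  have hzero : L ((X - C u) * (1 - d)) = 0 := by
    have : (X - C u) * (1 - d) = W * (1 - d) * (X - g) := by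
      rw [hfac]
      linear_combination (-(X - C u) * (1 - d)) * hW
    rw [this, hLmul]
  have hlin : L ((X - C u) * (1 - d)) = L (X * (1 - d)) - u * L (1 - d) := by
    simp only [hL, Finset.mul_sum, ← Finset.sum_sub_distrib]
    refine Finset.sum_congr rfl fun m _ => ?_
    rw [← coeff_C_mul, ← map_sub]
    congr 1
    ring
  rw [hzero, hL1, mul_one, hLX] at hlin
  rw [hM]
  exact (sub_eq_zero.1 hlin.symm).symm

end Lagrange

/-! ### Roots modulo a power of T, and reduction of two variables to one -/

section Furstenberg

open Polynomial

variable {F R : Type*} [Field F] [CharZero F] [CommRing R] [Algebra F R]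

/-- Lagrange inversion in the quotient of R[T] by T^k, where the class of T is nilpotent;
coefficients below k are well defined there. -/
theorem coeff_eq_sum_coeff_coeff_pow {k : ℕ} {G : Polynomial (Polynomial R)} {u : Polynomial R}
    (h0 : X ∣ G.coeff 0) (h1 : X ∣ G.coeff 1) (hu : X ∣ u) (hroot : X ^ k ∣ G.eval u - u)
    {a : ℕ} (ha : a < k) :
    u.coeff a =
      ∑ m ∈ Finset.range (2 * k), ((m : F) + 1)⁻¹ • ((G ^ (m + 1)).coeff m).coeff a := by
  set I : Ideal (Polynomial R) := Ideal.span {X ^ k} with hI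
  set π := Ideal.Quotient.mkₐ F I with hπ
  have hmem : ∀ p, π p = 0 ↔ X ^ k ∣ p := fun p => by
    rw [hπ, Ideal.Quotient.mkₐ_eq_mk, Ideal.Quotient.eq_zero_iff_mem, Ideal.mem_span_singleton]
  have key := eq_sum_coeff_pow_of_eval_eq (F := F) (t := π X) (k := k)
    (G := G.map (π : Polynomial R →+* _)) (u := π u)
    (by rw [← map_pow, hmem]) (by rw [coeff_map]; exact map_dvd π h0)
    (by rw [coeff_map]; exact map_dvd π h1) (map_dvd π hu)
    (by
      have : eval (π u) (G.map (π : Polynomial R →+* _)) = π (eval u G) := by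
        exact (eval_map _ _).trans (eval₂_at_apply (RingHomClass.toRingHom π) u)
      rw [this, ← sub_eq_zero, ← map_sub, hmem]
      exact hroot)
  have hsum : π u = π (∑ m ∈ Finset.range (2 * k), ((m : F) + 1)⁻¹ • (G ^ (m + 1)).coeff m) := by
    rw [key, map_sum]
    refine Finset.sum_congr rfl fun m _ => ?_
    rw [← Polynomial.map_pow, coeff_map, map_smul]
    rfl
  rw [← sub_eq_zero, ← map_sub, hmem] at hsum
  have := Polynomial.coeff_eq_of_X_pow_dvd_sub hsum ha
  rw [this, finsetSum_coeff]
  rfl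

/-- The substitution `T ↦ y²`, `z ↦ ζ y`, for a new variable `ζ`. -/
noncomputable def weightHom (R : Type*) [CommRing R] :
    Polynomial (Polynomial R) →+* Polynomial (Polynomial R) :=
  eval₂RingHom (eval₂RingHom (C.comp C) (X ^ 2)) (C X * X)

/-- The substitution `T ↦ y²`, `z ↦ c y`, for a constant `c`. -/
noncomputable def weightEval (c : R) : Polynomial (Polynomial R) →+* Polynomial R :=
  eval₂RingHom (eval₂RingHom C (X ^ 2)) (C c * X)

theorem map_evalRingHom_weightHom (c : R) (Γ : Polynomial (Polynomial R)) :
    (weightHom R Γ).map (evalRingHom c) = weightEval c Γ := by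
  have : (mapRingHom (evalRingHom c)).comp (weightHom R) = weightEval c := by
    ext <;> simp [weightHom, weightEval]
  exact congrArg (fun f => f Γ) this

theorem weightHom_monomial (a b : ℕ) (r : R) :
    weightHom R (monomial b (monomial a r)) = monomial (2 * a + b) (monomial b r) := by
  simp only [weightHom, coe_eval₂RingHom, eval₂_monomial, RingHom.comp_apply]
  rw [mul_pow, ← pow_mul, ← C_pow, ← C_mul_X_pow_eq_monomial, ← C_mul_X_pow_eq_monomial, C_mul,
    pow_add]
  ring

theorem natDegree_coeff_weightHom_le (Γ : Polynomial (Polynomial R)) (N : ℕ) :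
    ((weightHom R Γ).coeff N).natDegree ≤ N := by
  induction Γ using Polynomial.induction_on' with
  | add p q hp hq =>
    rw [map_add, coeff_add]
    exact natDegree_add_le_of_degree_le hp hq
  | monomial b f =>
    induction f using Polynomial.induction_on' with
    | add p q hp hq =>
      rw [map_add, map_add, coeff_add]
      exact natDegree_add_le_of_degree_le hp hq
    | monomial a r =>
      rw [weightHom_monomial, coeff_monomial]
      split_ifs with h
      · exact (natDegree_monomial_le r).trans (by omega)
      · simp

/-- The monomial T^a z^b goes to ζ^b y^(2a+b), and the two exponents determine a and b, so no two
monomials are mixed. -/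
theorem coeff_coeff_weightHom (Γ : Polynomial (Polynomial R)) (a m : ℕ) :
    ((weightHom R Γ).coeff (2 * a + m)).coeff m = (Γ.coeff m).coeff a := by
  induction Γ using Polynomial.induction_on' with
  | add p q hp hq => simp only [map_add, coeff_add, hp, hq]
  | monomial b f =>
    induction f using Polynomial.induction_on' with
    | add p q hp hq => simp only [map_add, coeff_add, hp, hq]
    | monomial a' r =>
      rw [weightHom_monomial, coeff_monomial, coeff_monomial]
      by_cases hb : b = m
      · subst hb
        by_cases ha : a' = a
        · subst ha; simp
        · rw [if_neg (by omega), if_pos rfl, coeff_monomial, if_neg ha, coeff_zero]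
      · rw [if_neg hb, coeff_zero]
        split_ifs
        · rw [coeff_monomial, if_neg hb]
        · rw [coeff_zero]

/-- The coefficient of y^(2a+m) is a polynomial in ζ of degree at most 2a + m, so its coefficient of
ζ^m is interpolated from integer values of ζ. -/
theorem coeff_coeff_mem_span_weightEval (Γ : Polynomial (Polynomial R)) {a m N : ℕ}
    (h : 2 * a + m < N) :
    (Γ.coeff m).coeff a ∈ Submodule.span F
      ((fun ζ : ℕ => (weightEval (algebraMap F R ζ) Γ).coeff (2 * a + m)) ''
        (Finset.range N : Set ℕ)) := by
  rw [← coeff_coeff_weightHom]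
  have := Polynomial.coeff_mem_span_eval (F := F) ((weightHom R Γ).coeff (2 * a + m))
    (lt_of_le_of_lt (natDegree_coeff_weightHom_le Γ _) h) m
  convert this using 3
  rw [← map_evalRingHom_weightHom, coeff_map, coe_evalRingHom]

theorem X_pow_dvd_pow_sub_cut_pow (K m : ℕ) (f : Polynomial R) :
    X ^ K ∣ f ^ m - (f.cut K) ^ m :=
  (X_pow_dvd_sub_cut K f).trans (sub_dvd_pow_sub_pow _ _ _)

end Furstenberg

/-! ## Computing truncated roots -/

section Root

open Polynomial

variable {F V : Type*} [Field F] {S : Set (MvPolynomial V F)}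

/-- The polynomial `z - 𝒜 / ξ`, whose fixed points are the roots of `𝒜`. -/
noncomputable def fixedPointForm {R : Type*} [CommRing R] [Algebra F R] (ξ : F)
    (𝒜 : Polynomial (Polynomial R)) : Polynomial (Polynomial R) :=
  X - C (C (algebraMap F R ξ⁻¹)) * 𝒜

theorem weightEval_fixedPointForm {R : Type*} [CommRing R] [Algebra F R] (ξ : F)
    (𝒜 : Polynomial (Polynomial R)) (c : R) :
    weightEval c (fixedPointForm ξ 𝒜) = C c * X - C (algebraMap F R ξ⁻¹) * weightEval c 𝒜 := by
  simp [fixedPointForm, weightEval]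

theorem Gen.eval_cut_fixedPointForm (ξ : F) (𝒜 : Polynomial (Polynomial (MvPolynomial V F)))
    {Z K N : ℕ} (hK : 0 < K)
    (hS : ∀ ζ < Z, ∀ i < K,
      (weightEval (algebraMap F _ ((ζ : ℕ) : F)) 𝒜).coeff i ∈ S ∪ constSet F V) :
    Gen S 2 (Z * (N * (3 * (2 * K)))) {q | ∃ ζ < Z, ∃ η < N,
      q = ((weightEval (algebraMap F _ ((ζ : ℕ) : F)) (fixedPointForm ξ 𝒜)).cut K).eval
        (algebraMap F _ ((η : ℕ) : F))} := by
  classical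
  refine (Gen.biUnion_const (Finset.range Z) (fun ζ hζ => Gen.biUnion_const (Finset.range N)
    (X := fun η => {((weightEval (algebraMap F _ ((ζ : ℕ) : F)) (fixedPointForm ξ 𝒜)).cut K).eval
        (algebraMap F _ ((η : ℕ) : F))}) (fun η _ => ?_)
    (Finset.card_range N).le) (Finset.card_range Z).le).mono Set.subset_union_left ?_ le_rfl le_rfl
  -- The extra index `none` carries the constant 1, needed for the summand ζ y of the fixed point
  -- form. The K + 1 terms are counted as 2 K.
  · refine Gen.of_mem_span (Finset.insertNone (Finset.range K)) (f := fun o => o.elim 1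
      fun i => (weightEval (algebraMap F _ ((ζ : ℕ) : F)) 𝒜).coeff i) ?_ (by simp; omega)
      (Submodule.span_le.2 ?_ (eval_cut_mem_span K _ (η : F)))
    · rintro (_ | i) hi
      · exact Or.inr ⟨1, map_one _⟩
      · exact hS ζ (Finset.mem_range.1 hζ) i (by simpa using hi)
    · rintro _ ⟨i, hi, rfl⟩
      have e : (weightEval (algebraMap F (MvPolynomial V F) ((ζ : ℕ) : F))
          (fixedPointForm ξ 𝒜)).coeff i = (if i = 1 then (ζ : F) else 0) • 1 -
          ξ⁻¹ • (weightEval (algebraMap F (MvPolynomial V F) ((ζ : ℕ) : F)) 𝒜).coeff i := by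
        rw [weightEval_fixedPointForm, coeff_sub, coeff_C_mul, coeff_C_mul, coeff_X,
          Algebra.smul_def, Algebra.smul_def, mul_one]
        congr 1
        by_cases h : i = 1
        · simp [h]
        · simp [h, Ne.symm h]
      rw [SetLike.mem_coe, e]
      refine Submodule.sub_mem _ (Submodule.smul_mem _ _ (Submodule.subset_span ⟨none, ?_, rfl⟩))
        (Submodule.smul_mem _ _ (Submodule.subset_span ⟨some i, ?_, rfl⟩))
      · simp
      · simpa using hi
  · rintro q ⟨ζ, hζ, η, hη, rfl⟩
    exact Set.mem_biUnion (Finset.mem_coe.2 (Finset.mem_range.2 hζ))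
      (Set.mem_biUnion (Finset.mem_coe.2 (Finset.mem_range.2 hη)) rfl)

theorem Gen.of_mem_span_pow {ι : Type*} (P : Finset ι) (v : ι → MvPolynomial V F) (m : ι → ℕ)
    {Y : Set (MvPolynomial V F)} {N M : ℕ} (hv : ∀ x ∈ P, v x ∈ Y) (hm : ∀ x ∈ P, m x ≤ M)
    (hN : P.card ≤ N) {p : MvPolynomial V F}
    (hp : p ∈ Submodule.span F ((fun x => v x ^ m x) '' P)) :
    Gen Y 3 (N * M + 3 * N) {p} := by
  have s2 : Gen Y 1 (N * M) (⋃ x ∈ P, {v x ^ m x}) := by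
    refine Gen.biUnion_const P (fun x hx => ?_) hN
    have := Gen.prod (S := Y) (l := Multiset.replicate (m x) (v x)) fun p hp => by
      rw [Multiset.eq_of_mem_replicate hp]
      exact Or.inl (hv x hx)
    rw [Multiset.prod_replicate, Multiset.card_replicate] at this
    exact this.mono Set.subset_union_left subset_rfl le_rfl (hm x hx)
  have hmem : ∀ x ∈ P, v x ^ m x ∈ (⋃ x ∈ P, {v x ^ m x}) ∪ constSet F V := fun x hx =>
    Or.inl (Set.mem_biUnion (t := fun x => {v x ^ m x}) hx rfl)
  exact s2.comp (Gen.of_mem_span (f := fun x => v x ^ m x) P hmem hN hp)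

variable [CharZero F]

/-- Three linear operations in a row: Lagrange inversion, a sum over m < 2k; interpolation in ζ,
where 2a + m < 4k gives both the number of nodes and the order of truncation; interpolation in y at
points η of the (m+1)-st power of a truncated polynomial. They merge into one linear combination of
powers. -/
theorem coeff_root_mem_span {R : Type*} [CommRing R] [Algebra F R] {k : ℕ}
    {G : Polynomial (Polynomial R)} {u : Polynomial R}
    (h0 : X ∣ G.coeff 0) (h1 : X ∣ G.coeff 1) (hu : X ∣ u) (hroot : X ^ k ∣ G.eval u - u)
    {a : ℕ} (ha : a < k) :
    u.coeff a ∈ Submodule.span F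
      ((fun x : ℕ × ℕ × ℕ => (((weightEval (algebraMap F R x.1) G).cut (4 * k)).eval
        (algebraMap F R x.2.1)) ^ (x.2.2 + 1)) ''
      (Finset.range (4 * k) ×ˢ Finset.range (8 * k ^ 2) ×ˢ Finset.range (2 * k) :
        Finset (ℕ × ℕ × ℕ))) := by
  rw [coeff_eq_sum_coeff_coeff_pow (F := F) h0 h1 hu hroot ha]
  refine Submodule.sum_mem _ fun m hm => Submodule.smul_mem _ _ ?_
  have hm' := Finset.mem_range.1 hm
  refine Submodule.span_le.2 ?_ (coeff_coeff_mem_span_weightEval (F := F) (G ^ (m + 1))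
    (a := a) (m := m) (N := 4 * k) (by omega))
  rintro _ ⟨ζ, hζ, rfl⟩
  -- The power m + 1 ≤ 2k of a polynomial of degree at most 4k - 1.
  have hdeg : (((weightEval (algebraMap F R ζ) G).cut (4 * k)) ^ (m + 1)).natDegree <
      8 * k ^ 2 := by
    have h := natDegree_pow_le_of_le (m + 1)
      (natDegree_cut_le (4 * k) (weightEval (algebraMap F R ζ) G))
    calc _ ≤ (m + 1) * (4 * k - 1) := h
      _ ≤ 2 * k * (4 * k - 1) := Nat.mul_le_mul_right _ (by omega)
      _ < 2 * k * (4 * k) := (Nat.mul_lt_mul_left (by omega)).2 (by omega)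
      _ = 8 * k ^ 2 := by ring
  rw [SetLike.mem_coe]
  dsimp only
  rw [map_pow, coeff_eq_of_X_pow_dvd_sub (X_pow_dvd_pow_sub_cut_pow (4 * k) (m + 1) _)
    (show 2 * a + m < 4 * k by omega)]
  refine Submodule.span_mono ?_ (coeff_mem_span_eval (F := F) _ hdeg _)
  rintro _ ⟨η, hη, rfl⟩
  refine ⟨(ζ, η, m), ?_, by simp⟩
  simp only [Finset.coe_product, Set.mem_prod]
  exact ⟨hζ, hη, hm⟩

/-- The coefficients of a truncated root of `𝒜` are computed from the coefficients of
`𝒜(y², ζ y)` for `ζ < 4 * k`. -/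
theorem Gen.root_coeff {k : ℕ} (hk : 0 < k) (𝒜 : Polynomial (Polynomial (MvPolynomial V F)))
    {ξ : F} (hξ : ξ ≠ 0) (h0 : X ∣ 𝒜.coeff 0) (h1 : X ∣ 𝒜.coeff 1 - C (algebraMap F _ ξ))
    {u : Polynomial (MvPolynomial V F)} (hu : X ∣ u) (hroot : X ^ k ∣ 𝒜.eval u)
    (hS : ∀ ζ < 4 * k, ∀ i < 4 * k,
      (weightEval (algebraMap F _ ((ζ : ℕ) : F)) 𝒜).coeff i ∈ S ∪ constSet F V)
    {p : MvPolynomial V F} (hp : p ∈ Submodule.span F (u.coeff '' (Finset.range k : Set ℕ))) :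
    Gen S 5 (1100 * k ^ 5) {p} := by
  set G := fixedPointForm ξ 𝒜 with hG
  have hG0 : X ∣ G.coeff 0 := by
    have : G.coeff 0 = -(C (algebraMap F _ ξ⁻¹) * 𝒜.coeff 0) := by simp [hG, fixedPointForm]
    rw [this]
    exact (h0.mul_left _).neg_right
  have hG1 : X ∣ G.coeff 1 := by
    have : G.coeff 1 = -(C (algebraMap F _ ξ⁻¹) * (𝒜.coeff 1 - C (algebraMap F _ ξ))) := by
      have e : C (algebraMap F (MvPolynomial V F) ξ⁻¹) * C (algebraMap F _ ξ) = 1 := by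
        rw [← C_mul, ← map_mul, inv_mul_cancel₀ hξ, map_one, C_1]
      rw [mul_sub, e, hG, fixedPointForm, coeff_sub, coeff_X_one, coeff_C_mul]
      ring
    rw [this]
    exact (h1.mul_left _).neg_right
  have hGroot : X ^ k ∣ G.eval u - u := by
    have : G.eval u - u = -(C (algebraMap F _ ξ⁻¹) * 𝒜.eval u) := by
      simp [hG, fixedPointForm]
    rw [this]
    exact (hroot.mul_left _).neg_right
  -- The triples (ζ, η, m), 64 k^4 in number. The values before taking powers cost 768 k^4 edges,
  -- the powers 128 k^5 and the linear combination 192 k^4; together at most 1100 k^5.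
  set P := (Finset.range (4 * k) ×ˢ Finset.range (8 * k ^ 2) ×ˢ Finset.range (2 * k) :
        Finset (ℕ × ℕ × ℕ)) with hP
  have hcard : P.card = 64 * k ^ 4 := by
    simp only [hP, Finset.card_product, Finset.card_range]; ring
  set v : ℕ × ℕ × ℕ → MvPolynomial V F := fun x =>
    (((weightEval (algebraMap F _ (x.1 : F)) G).cut (4 * k)).eval
        (algebraMap F _ (x.2.1 : F))) ^ (x.2.2 + 1) with hv
  have hpP : p ∈ Submodule.span F (v '' P) := by
    refine Submodule.span_le.2 ?_ hp
    rintro _ ⟨a, ha, rfl⟩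
    exact coeff_root_mem_span hG0 hG1 hu hGroot (Finset.mem_range.1 ha)
  have s1 := Gen.eval_cut_fixedPointForm (N := 8 * k ^ 2) ξ 𝒜 (by omega) hS
  have s2 := Gen.of_mem_span_pow P _ (fun x => x.2.2 + 1) (M := 2 * k)
    (Y := {q | ∃ ζ < 4 * k, ∃ η < 8 * k ^ 2,
      q = ((weightEval (algebraMap F _ ((ζ : ℕ) : F)) (fixedPointForm ξ 𝒜)).cut (4 * k)).eval
        (algebraMap F (MvPolynomial V F) ((η : ℕ) : F))}) (fun x hx => by
      simp only [hP, Finset.mem_product, Finset.mem_range] at hx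
      exact ⟨x.1, hx.1, x.2.1, hx.2.1, rfl⟩) (fun x hx => by
      simp only [hP, Finset.mem_product, Finset.mem_range] at hx
      omega) hcard.le hpP
  refine (s1.comp s2).mono Set.subset_union_left subset_rfl le_rfl ?_
  have h45 : k ^ 4 ≤ k ^ 5 := Nat.pow_le_pow_right hk (by omega)
  have e1 : 4 * k * (8 * k ^ 2 * (3 * (2 * (4 * k)))) = 768 * k ^ 4 := by ring
  have e2 : 64 * k ^ 4 * (2 * k) = 128 * k ^ 5 := by ring
  rw [e1, e2]
  linarith

end Root

/-! ### Truncated roots of a polynomial given by a circuit -/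

section RootOfCircuit

open Polynomial

variable {F V V' : Type*} [Field F]

theorem RingHom.map_mvAeval {σ A B : Type*} [CommRing A] [Algebra F A] [CommRing B] [Algebra F B]
    (f : A →+* B) (hf : ∀ c : F, f (algebraMap F A c) = algebraMap F B c) (ψ : σ → A)
    (p : MvPolynomial σ F) :
    f (MvPolynomial.aeval ψ p) = MvPolynomial.aeval (fun v => f (ψ v)) p :=
  MvPolynomial.comp_aeval_apply ψ (AlgHom.mk f hf) p

theorem weightEval_algebraMap {R : Type*} [CommRing R] [Algebra F R] (c : R) (a : F) :
    weightEval c (algebraMap F (Polynomial (Polynomial R)) a) =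
      algebraMap F (Polynomial R) a := by
  simp [weightEval, Polynomial.algebraMap_apply]

theorem Polynomial.eval_mem_span_coeff {R : Type*} [CommRing R] [Algebra F R] (u : Polynomial R)
    {k : ℕ} (hu : u.natDegree < k) (τ : F) :
    u.eval (algebraMap F R τ) ∈ Submodule.span F (u.coeff '' (Finset.range k : Set ℕ)) := by
  have h := eval_cut_mem_span k u τ
  have e : u.cut k = u := by
    ext i
    rw [coeff_cut]
    split_ifs with hi
    · rfl
    · exact (coeff_eq_zero_of_natDegree_lt (by omega)).symm
  rwa [e] at h

variable {S : Set (MvPolynomial V F)}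

theorem coeff_C_mem {q : MvPolynomial V F} (hq : q ∈ S ∪ constSet F V) (i : ℕ) :
    (C q).coeff i ∈ S ∪ constSet F V := by
  rw [coeff_C]
  split_ifs
  · exact hq
  · exact Or.inr ⟨0, map_zero _⟩

variable [CharZero F]

/-- Let `𝒜` be obtained from a circuit by substituting polynomials in `T` and `z`, such that
`𝒜(0, z) = r(z)` has constant coefficients and a simple root at `0`. Then a root of `𝒜` modulo
`T ^ k` can be computed in size polynomial in `k` and the size of the circuit. -/
theorem Gen.root_of_circuit (D : Circuit F V')
    (ψ : V' → Polynomial (Polynomial (MvPolynomial V F)))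
    (hψ : ∀ v, D.Uses v → ∀ (c : F) (i : ℕ),
      (weightEval (algebraMap F _ c) (ψ v)).coeff i ∈ S ∪ constSet F V)
    {r : Polynomial F} (hr : (MvPolynomial.aeval ψ D.poly).map (evalRingHom 0) =
      r.map (algebraMap F (MvPolynomial V F))) (hr0 : r.coeff 0 = 0) (hr1 : r.coeff 1 ≠ 0)
    {u : Polynomial (MvPolynomial V F)} (hu : u.coeff 0 = 0) {k : ℕ} (hdeg : u.natDegree < k)
    (hroot : X ^ k ∣ (MvPolynomial.aeval ψ D.poly).eval u) (τ α : F) :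
    Gen S (5 * D.depth + 6) (448 * D.size ^ 2 * k ^ 3 + 1100 * k ^ 5 + 2)
      {u.eval (algebraMap F _ τ) + MvPolynomial.C α} := by
  have hk : 0 < k := by omega
  have hcoeff : ∀ i, ((MvPolynomial.aeval ψ D.poly).coeff i).coeff 0 = algebraMap F _ (r.coeff i) :=
    fun i => by
      have := congrArg (fun p => p.coeff i) hr
      simpa [coeff_map, coeff_zero_eq_eval_zero] using this
  -- One truncated substitution into the circuit for each of the 4k values of ζ.
  have h1 := Gen.biUnion_const (Finset.range (4 * k)) (S := S)
    (X := fun ζ => {q | ∃ i < 4 * k, q = (weightEval (algebraMap F _ ((ζ : ℕ) : F))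
      (MvPolynomial.aeval ψ D.poly)).coeff i})
    (fun ζ _ => by
      have := Gen.coeff_aeval (S := S) D
        (fun v => weightEval (algebraMap F _ ((ζ : ℕ) : F)) (ψ v)) (4 * k)
        fun v hv i _ => hψ v hv _ i
      rwa [← RingHom.map_mvAeval _ (weightEval_algebraMap _)] at this)
    (Finset.card_range _).le
  have h2 := Gen.root_coeff hk (MvPolynomial.aeval ψ D.poly) hr1
    (by rw [X_dvd_iff, hcoeff, hr0, map_zero])
    (by rw [X_dvd_iff, coeff_sub, hcoeff, coeff_C_zero, sub_self])
    (X_dvd_iff.2 hu) hroot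
    (S := ⋃ ζ ∈ Finset.range (4 * k), {q | ∃ i < 4 * k, q =
      (weightEval (algebraMap F _ ((ζ : ℕ) : F)) (MvPolynomial.aeval ψ D.poly)).coeff i})
    (fun ζ hζ i hi => Or.inl (Set.mem_iUnion₂.2 ⟨ζ, Finset.mem_range.2 hζ, i, hi, rfl⟩))
    (eval_mem_span_coeff u hdeg τ)
  have h3 := Gen.sum (S := {u.eval (algebraMap F _ τ)})
    (l := {u.eval (algebraMap F _ τ), MvPolynomial.C α}) (by
      simp only [Multiset.insert_eq_cons, Multiset.mem_cons, Multiset.mem_singleton]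
      rintro p (rfl | rfl)
      · exact Or.inl rfl
      · exact Or.inr ⟨_, rfl⟩)
  simp only [Multiset.insert_eq_cons, Multiset.sum_cons, Multiset.sum_singleton,
    Multiset.card_cons, Multiset.card_singleton] at h3
  refine ((h1.comp h2).comp h3).mono Set.subset_union_left subset_rfl (by omega) ?_
  have e : 4 * k * (7 * D.size ^ 2 * (4 * k) ^ 2) = 448 * D.size ^ 2 * k ^ 3 := by ring
  rw [e]

end RootOfCircuit

/-! ### Restriction to a line, and elements algebraic over the constants -/

section Derivative

variable {F ι : Type*} [Field F]

/-- Substitute `α + z` for the first variable and constants for the others. -/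
noncomputable def lineHom (α : F) (b : ι → F) : MvPolynomial (Option ι) F →ₐ[F] Polynomial F :=
  MvPolynomial.aeval fun v => v.elim (Polynomial.X + Polynomial.C α) fun i => Polynomial.C (b i)

theorem coeff_zero_lineHom (α : F) (b : ι → F) (A : MvPolynomial (Option ι) F) :
    (lineHom α b A).coeff 0 = MvPolynomial.eval (fun v => v.elim α b) A := by
  rw [lineHom, Polynomial.coeff_zero_eq_eval_zero, ← Polynomial.coe_evalRingHom,
    RingHom.map_mvAeval _ (by simp), MvPolynomial.aeval_eq_eval]
  congr 2
  ext v
  cases v <;> simp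

theorem coeff_one_lineHom (α : F) (b : ι → F) (A : MvPolynomial (Option ι) F) :
    (lineHom α b A).coeff 1 =
      MvPolynomial.eval (fun v => v.elim α b) (MvPolynomial.pderiv none A) := by
  induction A using MvPolynomial.induction_on with
  | C a => simp [lineHom]
  | add p q hp hq => simp only [map_add, Polynomial.coeff_add, hp, hq]
  | mul_X p v hp =>
    rw [map_mul, Polynomial.mul_coeff_one, hp, Derivation.leibniz, coeff_zero_lineHom]
    cases v with
    | none =>
      simp [lineHom, Polynomial.coeff_C, Polynomial.coeff_X]
      ring
    | some i =>
      simp [lineHom, Polynomial.coeff_C]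
      ring

/-- A polynomial that is algebraic over the constants is constant. -/
theorem MvPolynomial.exists_eq_C_of_aeval_eq_zero [Infinite F] {p : Polynomial F} (hp : p ≠ 0)
    {f : MvPolynomial ι F} (hf : Polynomial.aeval f p = 0) : ∃ c, f = MvPolynomial.C c := by
  classical
  -- At every point of F the value of f is a root of p in F, so the product vanishes as a function,
  -- hence as a polynomial over an infinite field. It need not be assumed that p splits.
  have h : ∏ c ∈ p.roots.toFinset, (f - MvPolynomial.C c) = 0 := by
    refine MvPolynomial.funext fun x => ?_
    rw [map_prod, map_zero, Finset.prod_eq_zero_iff]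
    refine ⟨MvPolynomial.eval x f, ?_, by simp⟩
    rw [Multiset.mem_toFinset, Polynomial.mem_roots hp, Polynomial.IsRoot.def]
    have := congrArg (MvPolynomial.eval x) hf
    rw [map_zero, Polynomial.aeval_def, Polynomial.hom_eval₂] at this
    rw [← this, Polynomial.eval, Polynomial.eval₂_eq_eval_map, Polynomial.eval₂_eq_eval_map]
    congr 1
    congr 1
    ext a
    simp [MvPolynomial.algebraMap_eq]
  obtain ⟨c, -, hc⟩ := Finset.prod_eq_zero_iff.1 h
  exact ⟨c, sub_eq_zero.1 hc⟩

end Derivative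

/-! ### Circuits for approximate roots and for simple roots -/

section Applications

open Polynomial

variable {F V ι : Type*} [Field F] {S : Set (MvPolynomial V F)}

/-- Substitutions that kill `T` factor through `A(0, x, z)`. -/
theorem aeval_eq_of_setTZero_eq {n : ℕ} {B : Type*} [CommRing B] [Algebra F B]
    {A : MvPolynomial (TXZ n) F} {p : Polynomial F}
    (hp : setTZero A = aeval (MvPolynomial.X none : MvPolynomial (TXZ n) F) p)
    (ψ : TXZ n → B) (h : ψ (some none) = 0) : MvPolynomial.aeval ψ A = aeval (ψ none) p := by
  have e : MvPolynomial.aeval ψ (setTZero A) = MvPolynomial.aeval ψ A := by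
    rw [setTZero, MvPolynomial.comp_aeval_apply]
    congr 2
    ext v
    split_ifs with hv
    · rw [hv, h, map_zero]
    · rw [MvPolynomial.aeval_X]
  rw [← e, hp, ← aeval_algHom_apply, MvPolynomial.aeval_X]

theorem natDegree_aeval_lt_of_isTruncated {n k : ℕ} {Φ : MvPolynomial (TX n) F}
    (h : IsTruncated Φ k) (x : Fin n → MvPolynomial V F) :
    (MvPolynomial.aeval (fun v : TX n => v.elim (X : Polynomial (MvPolynomial V F))
      fun j => C (x j)) Φ).natDegree < k := by
  have e : MvPolynomial.aeval (fun v : TX n => v.elim (X : Polynomial (MvPolynomial V F))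
      fun j => C (x j)) Φ = mapAlgHom (MvPolynomial.aeval x)
        (MvPolynomial.optionEquivLeft F (Fin n) Φ) := by
    have : MvPolynomial.aeval (fun v : TX n => v.elim (X : Polynomial (MvPolynomial V F))
      fun j => C (x j)) = (mapAlgHom (MvPolynomial.aeval x)).comp
        (MvPolynomial.optionEquivLeft F (Fin n)).toAlgHom := by
      refine MvPolynomial.algHom_ext fun v => ?_
      cases v <;> simp [MvPolynomial.optionEquivLeft_X_none, MvPolynomial.optionEquivLeft_X_some]
    rw [this]
    rfl
  rw [e]
  refine lt_of_le_of_lt natDegree_map_le ?_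
  rw [MvPolynomial.natDegree_optionEquivLeft]
  exact h

theorem natDegree_mvAeval_le {R : Type*} [CommRing R] [Algebra F R] (y : ι → Polynomial R)
    (hy : ∀ i, (y i).natDegree ≤ 1) (g : MvPolynomial ι F) :
    (MvPolynomial.aeval y g).natDegree ≤ g.totalDegree := by
  rw [MvPolynomial.aeval_def, MvPolynomial.eval₂_eq]
  refine natDegree_sum_le_of_forall_le _ _ fun m hm => ?_
  rw [Polynomial.algebraMap_apply]
  refine (natDegree_C_mul_le _ _).trans ((natDegree_prod_le _ _).trans ?_)
  refine (Finset.sum_le_sum fun i _ => natDegree_pow_le_of_le (m i) (hy i)).trans ?_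
  simp only [mul_one]
  exact MvPolynomial.le_totalDegree hm

/-- At `T = 0`, an approximate root of a `T`-regularized polynomial is constant. -/
theorem IsApproxRoot.constant_at_zero [CharZero F] {n k : ℕ} {A : MvPolynomial (TXZ n) F}
    {Φ : MvPolynomial (TX n) F} (hk : 0 < k) {p : Polynomial F} (hp0 : p ≠ 0)
    (hp : setTZero A = aeval (MvPolynomial.X none : MvPolynomial (TXZ n) F) p)
    (happ : IsApproxRoot A Φ k) :
    MvPolynomial.aeval (fun v : TX n => v.elim 0 MvPolynomial.X) Φ =
      (MvPolynomial.C (MvPolynomial.eval (fun _ => 0) Φ) : MvPolynomial (Fin n) F) := by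
  set θ : MvPolynomial (TX n) F →ₐ[F] MvPolynomial (Fin n) F :=
    MvPolynomial.aeval (fun v : TX n => v.elim 0 MvPolynomial.X) with hθ
  obtain ⟨c, hc⟩ : ∃ c, θ Φ = MvPolynomial.C c := by
    refine MvPolynomial.exists_eq_C_of_aeval_eq_zero hp0 ?_
    have h1 : θ (substZ A Φ) = 0 := by
      obtain ⟨q, hq⟩ := happ
      rw [hq, map_mul, map_pow]
      simp [hθ, hk.ne']
    rw [substZ, MvPolynomial.comp_aeval_apply, aeval_eq_of_setTZero_eq hp _ (by simp [hθ])] at h1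
    exact h1
  have h2 := congrArg (MvPolynomial.eval fun _ => 0) hc
  rw [MvPolynomial.eval_C, RingHom.map_mvAeval _ (by simp [MvPolynomial.algebraMap_eq]),
    MvPolynomial.aeval_eq_eval] at h2
  rw [hc, ← h2]
  congr 3
  ext v
  cases v <;> simp

/-- Approximate roots of a circuit can be evaluated by a circuit of comparable depth. -/
theorem Gen.approxRoot [CharZero F] {n k : ℕ} (D : Circuit F (TXZ n)) {Φ : MvPolynomial (TX n) F}
    (hk : 0 < k) (hreg : TRegularized D.poly) (htr : IsTruncated Φ k)
    (hnd : IsNondegenerate D.poly Φ)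
    (happ : IsApproxRoot D.poly Φ k) (x : Fin n → MvPolynomial V F)
    (hx : ∀ j, D.Uses (some (some j)) → x j ∈ S ∪ constSet F V) (τ : F) :
    Gen S (5 * D.depth + 6) (448 * D.size ^ 2 * k ^ 3 + 1100 * k ^ 5 + 2)
      {MvPolynomial.aeval (fun v : TX n => v.elim (MvPolynomial.C τ) x) Φ} := by
  set α := MvPolynomial.eval (fun _ => 0) Φ with hα
  obtain ⟨p, hp⟩ := hreg
  set r : Polynomial F := lineHom α (fun _ => 0) D.poly with hr
  have hrp : r = aeval (X + C α) p := by
    rw [hr, lineHom, aeval_eq_of_setTZero_eq hp _ (by simp)]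
    rfl
  have hr1 : r.coeff 1 ≠ 0 := by
    rw [hr, coeff_one_lineHom]
    exact hnd
  have hr0 : r.coeff 0 = 0 := by
    rw [hr, coeff_zero_lineHom]
    obtain ⟨q, hq⟩ := happ
    have h := congrArg (MvPolynomial.eval fun _ => 0) hq
    rw [map_mul, map_pow, MvPolynomial.eval_X, zero_pow hk.ne', zero_mul, substZ,
      RingHom.map_mvAeval _ (by simp [MvPolynomial.algebraMap_eq]),
      MvPolynomial.aeval_eq_eval] at h
    refine Eq.trans ?_ h
    congr 2
    ext v
    cases v <;> simp [hα]
  have hp0 : p ≠ 0 := by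
    rintro rfl
    simp [hrp] at hr1
  set Ψ : Polynomial (MvPolynomial V F) := MvPolynomial.aeval
    (fun v : TX n => v.elim (X : Polynomial (MvPolynomial V F)) fun j => C (x j)) Φ with hΨ
  -- This is A(T, x, z + α), so the root to be found is Φ - α. At T = 0 it becomes p(z + α), free of
  -- x, with a simple zero at 0 by non-degeneracy.
  set ψ : TXZ n → Polynomial (Polynomial (MvPolynomial V F)) := fun v =>
    v.elim (X + C (C (MvPolynomial.C α))) fun w => w.elim (C X) fun j => C (C (x j)) with hψ
  have key := Gen.root_of_circuit (S := S) D ψ (r := r) (u := Ψ - C (MvPolynomial.C α)) (k := k)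
    ?_ ?_ hr0 hr1 ?_ ?_ ?_ τ α
  · convert key using 2
    rw [eval_sub, eval_C, sub_add_cancel, hΨ, ← coe_evalRingHom, RingHom.map_mvAeval _
      (by simp [Polynomial.algebraMap_apply])]
    congr 2
    ext v : 1
    cases v <;> simp [MvPolynomial.algebraMap_eq]
  · rintro (_ | _ | j) hv c i
    · have e : (weightEval (algebraMap F _ c) (ψ none)).coeff i = MvPolynomial.C
          ((if i = 1 then c else 0) + if i = 0 then α else 0) := by
        simp only [hψ, weightEval, Option.elim, coe_eval₂RingHom, eval₂_X, eval₂_C,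
          coeff_add, coeff_C_mul, coeff_X, coeff_C, eq_comm (a := 1), map_add]
        congr 1
        · split_ifs <;> simp [MvPolynomial.algebraMap_eq]
        · split_ifs <;> simp
      exact Or.inr ⟨_, e.symm⟩
    · have e : (weightEval (algebraMap F _ c) (ψ (some none))).coeff i =
          MvPolynomial.C (if i = 2 then 1 else 0) := by
        simp only [hψ, weightEval, Option.elim, coe_eval₂RingHom, eval₂_X, eval₂_C, coeff_X_pow]
        split_ifs <;> simp
      exact Or.inr ⟨_, e.symm⟩
    · have e : weightEval (algebraMap F _ c) (ψ (some (some j))) = C (x j) := by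
        simp [hψ, weightEval]
      rw [e]
      exact coeff_C_mem (hx j hv) i
  · have hf : ∀ c : F, mapRingHom (evalRingHom (0 : MvPolynomial V F))
        (algebraMap F (Polynomial (Polynomial (MvPolynomial V F))) c) =
        algebraMap F (Polynomial (MvPolynomial V F)) c := fun c => by
      simp [Polynomial.algebraMap_apply]
    rw [← coe_mapRingHom, RingHom.map_mvAeval (F := F) (A := Polynomial (Polynomial (MvPolynomial V F)))
        (B := Polynomial (MvPolynomial V F)) (mapRingHom (evalRingHom 0)) hf,
      aeval_eq_of_setTZero_eq hp _ (by simp [hψ]), hrp]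
    change _ = mapAlgHom (Algebra.ofId F (MvPolynomial V F)) (aeval (X + C α) p)
    rw [← aeval_algHom_apply]
    congr 2
    simp only [hψ, Option.elim, coe_mapRingHom, Polynomial.map_add, map_X, map_C, coe_evalRingHom,
      eval_C, coe_mapAlgHom]
    rfl
  -- Φ(0, x) is a root of the univariate p, hence constant and equal to α; so T divides Φ - α for
  -- every choice of the x.
  · have h := congrArg (MvPolynomial.aeval x) (IsApproxRoot.constant_at_zero hk hp0 hp happ)
    rw [MvPolynomial.comp_aeval_apply, MvPolynomial.aeval_C, MvPolynomial.algebraMap_eq] at h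
    rw [coeff_sub, coeff_C_zero, sub_eq_zero, ← h, coeff_zero_eq_eval_zero, ← coe_evalRingHom,
      RingHom.map_mvAeval _ (by simp [Polynomial.algebraMap_apply])]
    congr 2
    ext v : 1
    cases v <;> simp
  · refine lt_of_le_of_lt (natDegree_sub_C).le ?_
    exact natDegree_aeval_lt_of_isTruncated htr x
  · have hf : ∀ c : F, evalRingHom (Ψ - C (MvPolynomial.C α))
        (algebraMap F (Polynomial (Polynomial (MvPolynomial V F))) c) =
        algebraMap F (Polynomial (MvPolynomial V F)) c := fun c => by
      simp [Polynomial.algebraMap_apply]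
    rw [← coe_evalRingHom, RingHom.map_mvAeval (F := F) (A := Polynomial (Polynomial (MvPolynomial V F)))
      (B := Polynomial (MvPolynomial V F)) (evalRingHom _) hf]
    have h := map_dvd (MvPolynomial.aeval (fun v : TX n =>
      v.elim (X : Polynomial (MvPolynomial V F)) fun j => C (x j))) happ
    rw [map_pow, MvPolynomial.aeval_X, substZ, MvPolynomial.comp_aeval_apply] at h
    refine Dvd.dvd.trans h (dvd_of_eq ?_)
    congr 2
    ext v : 1
    rcases v with _ | _ | j <;> simp [hψ, hΨ]

/-- A simple root of the polynomial of a circuit is computed by a circuit of comparable depth. -/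
theorem Circuit.exists_circuit_root [CharZero F] (E : Circuit F (Option ι)) {g : MvPolynomial ι F}
    (hroot : MvPolynomial.aeval (fun v : Option ι => v.elim g MvPolynomial.X) E.poly = 0)
    (b : ι → F) (hnd : MvPolynomial.eval (fun v : Option ι => v.elim (MvPolynomial.eval b g) b)
      (MvPolynomial.pderiv none E.poly) ≠ 0) :
    ∃ G : Circuit F ι, G.poly = g ∧ G.depth ≤ 5 * E.depth + 7 ∧
      G.size ≤ (E.size + 1) * 2 + (448 * E.size ^ 2 * (g.totalDegree + 1) ^ 3 +
        1100 * (g.totalDegree + 1) ^ 5 + 2) := by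
  classical
  set α := MvPolynomial.eval b g with hα
  set δ : ι → MvPolynomial ι F := fun i => MvPolynomial.X i + MvPolynomial.C (-b i) with hδ
  obtain ⟨I, hI, hI'⟩ := E.exists_uses_finset
  have hshift : Gen (Set.range MvPolynomial.X) 1 ((E.size + 1) * 2)
      (⋃ v ∈ I, {q | ∃ i, v = some i ∧ q = δ i}) := by
    refine Gen.biUnion_const I (fun v _ => ?_) hI
    rcases v with _ | i
    · refine (Gen.base ?_).mono Set.subset_union_left subset_rfl (Nat.zero_le _) (Nat.zero_le _)
      rintro q ⟨i, hi, -⟩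
      exact absurd hi (by simp)
    · have := Gen.sum (S := Set.range (MvPolynomial.X (R := F)))
        (l := {MvPolynomial.X i, MvPolynomial.C (-b i)}) (by
        simp only [Multiset.insert_eq_cons, Multiset.mem_cons, Multiset.mem_singleton]
        rintro p (rfl | rfl)
        · exact Or.inl ⟨i, rfl⟩
        · exact Or.inr ⟨_, rfl⟩)
      simp only [Multiset.insert_eq_cons, Multiset.sum_cons, Multiset.sum_singleton,
        Multiset.card_cons, Multiset.card_singleton] at this
      refine this.mono Set.subset_union_left ?_ le_rfl le_rfl
      rintro q ⟨j, hj, rfl⟩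
      rw [Option.some.inj hj]
      rfl
  set S := ⋃ v ∈ I, {q | ∃ i, v = some i ∧ q = δ i} with hS
  have hδS : ∀ i, E.Uses (some i) → δ i ∈ S := fun i hi =>
    Set.mem_iUnion₂.2 ⟨some i, hI' _ hi, i, rfl, rfl⟩
  -- The line b + T(w - b). At T = 0 everything becomes constant, as `Gen.root_of_circuit` requires;
  -- at T = 1 the original variables return.
  set y : ι → Polynomial (MvPolynomial ι F) := fun i =>
    C (MvPolynomial.C (b i)) + X * C (δ i) with hy
  set Ψ : Polynomial (MvPolynomial ι F) := MvPolynomial.aeval y g with hΨ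
  set ψ : Option ι → Polynomial (Polynomial (MvPolynomial ι F)) := fun v =>
    v.elim (X + C (C (MvPolynomial.C α))) fun i => C (y i) with hψ
  -- Along the line g has degree at most its total degree in T, so at order `g.totalDegree + 1` the
  -- truncated root is g itself.
  have key := Gen.root_of_circuit (S := S) E ψ (r := lineHom α b E.poly)
    (u := Ψ - C (MvPolynomial.C α)) (k := g.totalDegree + 1) ?_ ?_ ?_ ?_ ?_ ?_ ?_ 1 α
  · obtain ⟨G, h1, h2, h3⟩ := (hshift.comp key).exists_circuit
    refine ⟨G, h1.trans ?_, h2.trans (by omega), h3⟩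
    rw [eval_sub, eval_C, sub_add_cancel, hΨ, ← coe_evalRingHom, RingHom.map_mvAeval _
      (by simp [Polynomial.algebraMap_apply])]
    refine Eq.trans ?_ (MvPolynomial.aeval_X_left_apply g)
    congr 2
    ext i : 1
    simp [hy, hδ]
  · rintro (_ | i) hv c m
    · have e : (weightEval (algebraMap F _ c) (ψ none)).coeff m = MvPolynomial.C
          ((if m = 1 then c else 0) + if m = 0 then α else 0) := by
        simp only [hψ, weightEval, Option.elim, coe_eval₂RingHom, eval₂_X, eval₂_C,
          coeff_add, coeff_C_mul, coeff_X, coeff_C, eq_comm (a := 1), map_add]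
        congr 1
        · split_ifs <;> simp [MvPolynomial.algebraMap_eq]
        · split_ifs <;> simp
      exact Or.inr ⟨_, e.symm⟩
    · have e : weightEval (algebraMap F _ c) (ψ (some i)) =
          C (MvPolynomial.C (b i)) + C (δ i) * X ^ 2 := by
        simp only [hψ, hy, weightEval, Option.elim, coe_eval₂RingHom, eval₂_add, eval₂_mul,
          eval₂_X, eval₂_C]
        ring
      rw [e, coeff_add, coeff_C, coeff_C_mul, coeff_X_pow]
      by_cases h0 : m = 0
      · exact Or.inr ⟨b i, by simp [h0]⟩
      · by_cases h2 : m = 2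
        · left
          simpa [h2] using hδS i hv
        · exact Or.inr ⟨0, by simp [h0, h2]⟩
  · have hf : ∀ c : F, mapRingHom (evalRingHom (0 : MvPolynomial ι F))
        (algebraMap F (Polynomial (Polynomial (MvPolynomial ι F))) c) =
        algebraMap F (Polynomial (MvPolynomial ι F)) c := fun c => by
      simp [Polynomial.algebraMap_apply]
    have hf' : ∀ c : F, mapRingHom (algebraMap F (MvPolynomial ι F)) (algebraMap F _ c) =
        algebraMap F (Polynomial (MvPolynomial ι F)) c := fun c => by
      simp [Polynomial.algebraMap_apply]
    rw [← coe_mapRingHom, RingHom.map_mvAeval (F := F) (A := Polynomial (Polynomial (MvPolynomial ι F)))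
        (B := Polynomial (MvPolynomial ι F)) (mapRingHom (evalRingHom 0)) hf, lineHom,
      ← coe_mapRingHom, RingHom.map_mvAeval (F := F) (A := Polynomial F)
        (B := Polynomial (MvPolynomial ι F)) (mapRingHom (algebraMap F (MvPolynomial ι F))) hf']
    congr 2
    ext v : 1
    cases v <;> simp [hψ, hy, MvPolynomial.algebraMap_eq]
  · rw [coeff_zero_lineHom]
    have h := congrArg (MvPolynomial.eval b) hroot
    rw [map_zero, RingHom.map_mvAeval _ (by simp [MvPolynomial.algebraMap_eq]),
      MvPolynomial.aeval_eq_eval] at h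
    refine Eq.trans ?_ h
    congr 2
    ext v
    cases v <;> simp [hα]
  · rw [coeff_one_lineHom]
    exact hnd
  · rw [coeff_sub, coeff_C_zero, sub_eq_zero, coeff_zero_eq_eval_zero, ← coe_evalRingHom,
      RingHom.map_mvAeval _ (by simp [Polynomial.algebraMap_apply]), hα]
    have h := RingHom.map_mvAeval (F := F) (A := F) (B := MvPolynomial ι F) MvPolynomial.C
      (fun _ => rfl) b g
    rw [MvPolynomial.aeval_eq_eval] at h
    refine Eq.trans ?_ h.symm
    congr 2
    ext i : 1
    simp [hy]
  · refine Nat.lt_succ_of_le ((natDegree_sub_C).le.trans ?_)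
    exact natDegree_mvAeval_le y (fun i => by
      rw [hy]
      refine natDegree_add_le_of_degree_le ((natDegree_C _).trans_le (Nat.zero_le _)) ?_
      exact (natDegree_mul_C_le _ _).trans natDegree_X_le) g
  · have hf : ∀ c : F, evalRingHom (Ψ - C (MvPolynomial.C α))
        (algebraMap F (Polynomial (Polynomial (MvPolynomial ι F))) c) =
        algebraMap F (Polynomial (MvPolynomial ι F)) c := fun c => by
      simp [Polynomial.algebraMap_apply]
    rw [← coe_evalRingHom, RingHom.map_mvAeval (F := F) (A := Polynomial (Polynomial (MvPolynomial ι F)))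
      (B := Polynomial (MvPolynomial ι F)) (evalRingHom _) hf]
    have h := congrArg (MvPolynomial.aeval y) hroot
    rw [map_zero, MvPolynomial.comp_aeval_apply] at h
    refine Dvd.intro_left 0 ?_
    rw [zero_mul, ← h]
    congr 2
    ext v : 1
    cases v <;> simp [hψ, hΨ]

end Applications

/-! ## Lowering the multiplicity of a root -/

section Multiplicity

open Polynomial

variable {F ι : Type*} [Field F]

/-- The substitution `y ↦ y + ε` in the first variable. -/
noncomputable def shiftHom (F ι : Type*) [Field F] :
    MvPolynomial (Option ι) F →ₐ[F] Polynomial (MvPolynomial (Option ι) F) :=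
  MvPolynomial.aeval fun v =>
    v.elim (C (MvPolynomial.X none) + X) fun i => C (MvPolynomial.X (some i))

/-- The expansion around `y = g`. -/
noncomputable def expandHom (g : MvPolynomial ι F) :
    MvPolynomial (Option ι) F →ₐ[F] Polynomial (MvPolynomial ι F) :=
  MvPolynomial.aeval fun v => v.elim (C g + X) fun i => C (MvPolynomial.X i)

/-- The substitution ε ↦ y - g undoes the expansion. -/
theorem expandHom_ne_zero (g : MvPolynomial ι F) {P : MvPolynomial (Option ι) F} (hP : P ≠ 0) :
    expandHom g P ≠ 0 := by
  intro h
  apply hP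
  have h2 := congrArg (eval₂RingHom (MvPolynomial.rename (R := F) (some : ι → Option ι)).toRingHom
    (MvPolynomial.X none - MvPolynomial.rename some g)) h
  rw [map_zero, expandHom, RingHom.map_mvAeval (F := F) (A := Polynomial (MvPolynomial ι F))
    (B := MvPolynomial (Option ι) F) _ (by simp [Polynomial.algebraMap_apply,
      MvPolynomial.algebraMap_eq])] at h2
  rw [← h2]
  refine (MvPolynomial.aeval_X_left_apply P).symm.trans ?_
  congr 2
  ext v : 1
  cases v <;> simp

theorem coeff_expandHom (g : MvPolynomial ι F) (P : MvPolynomial (Option ι) F) (j : ℕ) :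
    (expandHom g P).coeff j = MvPolynomial.aeval (fun v : Option ι => v.elim g MvPolynomial.X)
      ((shiftHom F ι P).coeff j) := by
  have : expandHom g P = mapAlgHom (MvPolynomial.aeval
      (fun v : Option ι => v.elim g MvPolynomial.X)) (shiftHom F ι P) := by
    rw [expandHom, shiftHom, MvPolynomial.comp_aeval_apply]
    congr 2
    ext v : 1
    cases v <;> simp
  rw [this]
  simp

/-- Taylor's formula: the coefficient of ε^j in P(y + ε) is the j-th Hasse derivative in y, and this
survives restriction to the line. -/
theorem lineHom_coeff_shiftHom (α : F) (b : ι → F) (P : MvPolynomial (Option ι) F) (j : ℕ) :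
    lineHom α b ((shiftHom F ι P).coeff j) = hasseDeriv j (lineHom α b P) := by
  have h1 : mapAlgHom (lineHom α b) (shiftHom F ι P) =
      aeval (C X + X : Polynomial (Polynomial F)) (lineHom α b P) := by
    conv_rhs => rw [lineHom]
    rw [shiftHom, MvPolynomial.comp_aeval_apply, MvPolynomial.comp_aeval_apply]
    congr 2
    ext v : 1
    cases v
    · simp [lineHom, Polynomial.algebraMap_apply]
      ring
    · simp [lineHom, Polynomial.algebraMap_apply]
  have h2 : aeval (C X + X : Polynomial (Polynomial F)) (lineHom α b P) =
      taylor X ((lineHom α b P).map C) := by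
    rw [taylor_apply, comp, eval₂_map, aeval_def, add_comm (C X)]
    rfl
  have h3 := congrArg (fun p => p.coeff j) (h1.trans h2)
  have h4 : hasseDeriv j ((lineHom α b P).map C) = (hasseDeriv j (lineHom α b P)).map C := by
    ext m : 1
    simp [hasseDeriv_coeff]
  simp only [taylor_coeff, h4] at h3
  rw [eval_map, eval₂_C_X] at h3
  rw [← h3]
  simp

theorem coeff_lineHom_eq_eval_coeff_expandHom (g : MvPolynomial ι F) (b : ι → F)
    (P : MvPolynomial (Option ι) F) (j : ℕ) :
    (lineHom (MvPolynomial.eval b g) b P).coeff j =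
      MvPolynomial.eval b ((expandHom g P).coeff j) := by
  have : lineHom (MvPolynomial.eval b g) b P =
      mapRingHom (MvPolynomial.eval b) (expandHom g P) := by
    rw [expandHom, RingHom.map_mvAeval (F := F) (A := Polynomial (MvPolynomial ι F))
      (B := Polynomial F) _ (by simp [Polynomial.algebraMap_apply, MvPolynomial.algebraMap_eq]),
      lineHom]
    congr 2
    ext v : 1
    cases v
    · simp [add_comm]
    · simp
  rw [this, coe_mapRingHom, coeff_map]

/-- A root of the polynomial of a circuit is computed by a circuit of comparable depth. -/
theorem Circuit.exists_circuit_root_of_ne_zero [CharZero F] (E : Circuit F (Option ι))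
    (hE : E.poly ≠ 0) {g : MvPolynomial ι F}
    (hroot : MvPolynomial.aeval (fun v : Option ι => v.elim g MvPolynomial.X) E.poly = 0)
    {D : ℕ} (hD : (expandHom g E.poly).natDegree ≤ D) {e : ℕ} (he : 7 * E.size ^ 2 * D ^ 2 ≤ e) :
    ∃ G : Circuit F ι, G.poly = g ∧ G.depth ≤ 25 * E.depth + 7 ∧
      G.size ≤ (e + 1) * 2 + (448 * e ^ 2 * (g.totalDegree + 1) ^ 3 +
        1100 * (g.totalDegree + 1) ^ 5 + 2) := by
  classical
  set q := expandHom g E.poly with hq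
  have hex : ∃ m, q.coeff m ≠ 0 := by
    by_contra! h
    exact expandHom_ne_zero g hE (Polynomial.ext h)
  have hq0 : q.coeff 0 = 0 := by
    have hf : ∀ c : F, evalRingHom (0 : MvPolynomial ι F)
        (algebraMap F (Polynomial (MvPolynomial ι F)) c) = algebraMap F _ c := fun c => by
      simp [Polynomial.algebraMap_apply]
    rw [← hroot, hq, coeff_zero_eq_eval_zero, ← coe_evalRingHom, expandHom,
      RingHom.map_mvAeval (F := F) (A := Polynomial (MvPolynomial ι F)) (evalRingHom 0) hf]
    congr 2
    ext v : 1
    cases v <;> simp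
  -- The multiplicity of the root g is j + 1, so the coefficient of ε^j in P(y + ε) vanishes at y =
  -- g to first order only.
  obtain ⟨j, hj⟩ : ∃ j, Nat.find hex = j + 1 := by
    refine Nat.exists_eq_succ_of_ne_zero fun h => ?_
    exact (h ▸ Nat.find_spec hex) hq0
  have hj1 : q.coeff (j + 1) ≠ 0 := hj ▸ Nat.find_spec hex
  have hj0 : q.coeff j = 0 := not_not.1 (Nat.find_min hex (m := j) (by omega))
  have hjD : j < D := lt_of_lt_of_le (Nat.lt_succ_self j) ((le_natDegree_of_ne_zero hj1).trans hD)
  have hgen := Gen.coeff_aeval (S := Set.range (MvPolynomial.X (R := F))) E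
    (fun v : Option ι => v.elim (C (MvPolynomial.X none) + X : Polynomial
      (MvPolynomial (Option ι) F)) fun i => C (MvPolynomial.X (some i))) D (by
      rintro (_ | i) _ m _
      · rw [Option.elim, coeff_add, coeff_C, coeff_X]
        by_cases h0 : m = 0
        · exact Or.inl ⟨none, by simp [h0]⟩
        · by_cases h1 : m = 1
          · exact Or.inr ⟨1, by simp [h1]⟩
          · exact Or.inr ⟨0, by simp [h0, Ne.symm h1]⟩
      · exact coeff_C_mem (Set.mem_union_left _ (Set.mem_range_self (some i))) m)
  have hsub : {(shiftHom F ι E.poly).coeff j} ⊆ {p | ∃ i < D, p = (MvPolynomial.aeval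
      (fun v : Option ι => v.elim (C (MvPolynomial.X none) + X : Polynomial
        (MvPolynomial (Option ι) F)) fun i => C (MvPolynomial.X (some i))) E.poly).coeff i} := by
    rintro _ rfl
    exact ⟨j, hjD, rfl⟩
  obtain ⟨E', hE', hdepth, hsize⟩ :=
    (hgen.mono Set.subset_union_left hsub le_rfl he).exists_circuit
  obtain ⟨b, hb⟩ : ∃ b, MvPolynomial.eval b (q.coeff (j + 1)) ≠ 0 := by
    by_contra! h
    exact hj1 (MvPolynomial.funext fun b => by rw [h b, map_zero])
  obtain ⟨G, h1, h2, h3⟩ := E'.exists_circuit_root (g := g)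
    (by rw [hE', ← coeff_expandHom]; exact hj0) b (by
      -- The derivative in y at the point over b is (j + 1) times the value at b of the coefficient
      -- of ε^(j+1); nonzero in characteristic zero.
      rw [hE', ← coeff_one_lineHom, lineHom_coeff_shiftHom, hasseDeriv_coeff,
        coeff_lineHom_eq_eval_coeff_expandHom, add_comm 1 j]
      refine mul_ne_zero ?_ hb
      rw [Nat.choose_symm_of_eq_add rfl, Nat.choose_one_right]
      exact Nat.cast_ne_zero.2 (Nat.succ_ne_zero j))
  refine ⟨G, h1, h2.trans (by omega), h3.trans ?_⟩
  gcongr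

end Multiplicity

/-! ## Polynomials in few variables -/

section FewVariables

open scoped Pointwise

variable {F V ι : Type*} [Field F]

/-- Because 1 lies in s, products of fewer factors are also products of exactly `g.totalDegree`
factors. -/
theorem MvPolynomial.aeval_mem_span_pow {R : Type*} [CommRing R] [Algebra F R] {s : Set R}
    (h1 : 1 ∈ s) {y : ι → R} (hy : ∀ i, y i ∈ Submodule.span F s) (g : MvPolynomial ι F) :
    MvPolynomial.aeval y g ∈ Submodule.span F (s ^ g.totalDegree) := by
  classical
  have hone : (1 : Submodule F R) ≤ Submodule.span F s := by
    rw [Submodule.one_le]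
    exact Submodule.subset_span h1
  rw [MvPolynomial.aeval_def, MvPolynomial.eval₂_eq, ← Submodule.span_pow]
  refine Submodule.sum_mem _ fun m hm => ?_
  rw [← Algebra.smul_def]
  refine Submodule.smul_mem _ _ ?_
  refine pow_le_pow_right₀ hone (MvPolynomial.le_totalDegree hm) ?_
  rw [Finsupp.sum, ← Finset.prod_pow_eq_pow_sum]
  induction m.support using Finset.induction_on with
  | empty =>
    rw [Finset.prod_empty, Finset.prod_empty]
    exact Submodule.one_le.1 le_rfl
  | insert i t hi ih =>
    rw [Finset.prod_insert hi, Finset.prod_insert hi]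
    exact Submodule.mul_mem_mul (Submodule.pow_mem_pow _ (hy i) _) ih

/-- The pointwise power of s has at most N^d elements, each a product gate with d inputs; one linear
combination follows. -/
theorem Gen.of_mem_span_setPow [DecidableEq (MvPolynomial V F)] {S : Set (MvPolynomial V F)}
    (s : Finset (MvPolynomial V F)) (hs : ∀ p ∈ s, p ∈ S ∪ constSet F V) (d : ℕ) {N : ℕ}
    (hN : s.card ≤ N) {p : MvPolynomial V F}
    (hp : p ∈ Submodule.span F ((s : Set (MvPolynomial V F)) ^ d)) :
    Gen S 3 (N ^ d * d + 3 * N ^ d) {p} := by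
  have hcard : (s ^ d).card ≤ N ^ d := Finset.card_pow_le.trans (Nat.pow_le_pow_left hN d)
  have h1 : Gen S 1 (N ^ d * d) (⋃ q ∈ s ^ d, {q}) := by
    refine Gen.biUnion_const _ (fun q hq => ?_) hcard
    obtain ⟨f, rfl⟩ := Finset.mem_pow.1 hq
    have := Gen.prod (S := S) (l := (List.ofFn fun i => (f i : MvPolynomial V F))) fun p hp => by
      obtain ⟨i, rfl⟩ := (List.mem_ofFn' _ _).1 (Multiset.mem_coe.1 hp)
      exact hs _ (f i).2
    simpa using this
  have hmem : ∀ q ∈ s ^ d, q ∈ (⋃ q ∈ s ^ d, {q}) ∪ constSet F V := fun q hq =>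
    Or.inl (Set.mem_biUnion (t := fun q => {q}) hq rfl)
  exact h1.comp (Gen.of_mem_span (s ^ d) (f := fun q => q) hmem hcard (by simpa using hp))

end FewVariables

/-! ## The hybrid argument -/

section Hybrid

open scoped Pointwise

variable {F : Type*} [Field F] {n σ μ ρ : ℕ}

/-- The substitution of the generator for the variables `x_j`, `j < i`. -/
noncomputable def hybrid (g : MvPolynomial (Fin σ) F) (S : Fin n → Finset (Fin μ))
    (hS : ∀ i, (S i).card = σ) (i : ℕ) :
    MvPolynomial (TX n) F →ₐ[F] MvPolynomial (TX n ⊕ Fin μ) F :=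
  MvPolynomial.aeval fun v : TX n => v.elim (MvPolynomial.X (Sum.inl none)) fun j =>
    if j.val < i then MvPolynomial.rename Sum.inr (kiCoord g S hS j)
    else MvPolynomial.X (Sum.inl (some j))

/-- The hybrids run from f itself to f on the generator, up to renaming, so a first vanishing step
exists. -/
theorem exists_hybrid_switch (g : MvPolynomial (Fin σ) F) (S : Fin n → Finset (Fin μ))
    (hS : ∀ i, (S i).card = σ) {f : MvPolynomial (TX n) F} (hf : f ≠ 0)
    (h0 : compKI g S hS f = 0) :
    ∃ i : Fin n, hybrid g S hS i f ≠ 0 ∧ hybrid g S hS (i + 1) f = 0 := by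
  by_contra! h
  have key : ∀ i ≤ n, hybrid g S hS i f ≠ 0 := by
    intro i
    induction i with
    | zero =>
      intro _ h
      apply hf
      apply MvPolynomial.rename_injective (Sum.inl : TX n → TX n ⊕ Fin μ) Sum.inl_injective
      rw [map_zero, ← h]
      change _ = MvPolynomial.aeval _ f
      rw [MvPolynomial.rename_eq_aeval]
      congr 2
      ext v : 1
      cases v <;> simp
    | succ i ih => exact fun hi => h ⟨i, hi⟩ (ih (by omega))
  apply key n le_rfl
  have h1 := congrArg (MvPolynomial.rename (fun v : TX μ => v.elim (Sum.inl none : TX n ⊕ Fin μ)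
    Sum.inr)) h0
  rw [map_zero, compKI, MvPolynomial.comp_aeval_apply] at h1
  rw [← h1, hybrid]
  congr 2
  ext v : 1
  rcases v with _ | j
  · simp
  · simp only [Option.elim, if_pos j.2, MvPolynomial.rename_rename]
    rfl

/-- Keep the variables of the block `s` and replace the others by the values in `e`. -/
noncomputable def restrictBlock (s : Finset (Fin μ)) (hs : s.card = σ) (e : Fin μ → F) :
    Fin μ → MvPolynomial (Fin σ) F :=
  Function.extend (s.orderEmbOfFin hs) MvPolynomial.X fun v => MvPolynomial.C (e v)

theorem restrictBlock_emb (s : Finset (Fin μ)) (hs : s.card = σ) (e : Fin μ → F) (t : Fin σ) :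
    restrictBlock s hs e (s.orderEmbOfFin hs t) = MvPolynomial.X t :=
  (s.orderEmbOfFin hs).injective.extend_apply _ _ t

theorem restrictBlock_of_notMem {s : Finset (Fin μ)} (hs : s.card = σ) (e : Fin μ → F)
    {v : Fin μ} (hv : v ∉ s) : restrictBlock s hs e v = MvPolynomial.C (e v) := by
  refine Function.extend_apply' _ _ v ?_
  rintro ⟨t, rfl⟩
  exact hv (Finset.orderEmbOfFin_mem _ _ t)

theorem exists_orderEmbOfFin_eq {s : Finset (Fin μ)} (hs : s.card = σ) {v : Fin μ} (hv : v ∈ s) :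
    ∃ t, s.orderEmbOfFin hs t = v := by
  have : v ∈ Set.range (s.orderEmbOfFin hs) := by rwa [Finset.range_orderEmbOfFin]
  exact this

theorem eval_restrictBlock (s : Finset (Fin μ)) (hs : s.card = σ) (e : Fin μ → F) (v : Fin μ) :
    MvPolynomial.eval (fun t => e (s.orderEmbOfFin hs t)) (restrictBlock s hs e v) = e v := by
  by_cases hv : v ∈ s
  · obtain ⟨t, rfl⟩ := exists_orderEmbOfFin_eq hs hv
    rw [restrictBlock_emb, MvPolynomial.eval_X]
  · rw [restrictBlock_of_notMem hs e hv, MvPolynomial.eval_C]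

/-- A polynomial of degree at most `d` in fewer than `ρ` variables, up to constants. -/
def IsLowCoord (ρ d : ℕ) (x : MvPolynomial (Fin σ) F) : Prop :=
  ∃ K : Finset (Fin σ), K.card ≤ ρ - 1 ∧
    x ∈ Submodule.span F
      ((insert 1 (MvPolynomial.X '' (K : Set (Fin σ))) : Set (MvPolynomial (Fin σ) F)) ^ d)

theorem isLowCoord_C (ρ d : ℕ) (a : F) :
    IsLowCoord ρ d (MvPolynomial.C a : MvPolynomial (Fin σ) F) := by
  refine ⟨∅, by simp, ?_⟩
  rw [← mul_one (MvPolynomial.C _), ← MvPolynomial.smul_eq_C_mul]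
  refine Submodule.smul_mem _ _ (Submodule.subset_span ?_)
  have := Set.pow_mem_pow (n := d) (Set.mem_insert (1 : MvPolynomial (Fin σ) F)
    (MvPolynomial.X '' ((∅ : Finset (Fin σ)) : Set (Fin σ))))
  rwa [one_pow] at this

/-- With the variables outside S_i fixed, the copy of g on S_j depends only on variables in S_i ∩
S_j. -/
theorem isLowCoord_kiCoord (g : MvPolynomial (Fin σ) F) {S : Fin n → Finset (Fin μ)}
    (hS : IsDesign n σ μ ρ S) {i j : Fin n} (hij : i ≠ j) (e : Fin μ → F) :
    IsLowCoord ρ g.totalDegree (MvPolynomial.aeval (restrictBlock (S i) (hS.card_eq i) e)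
      (kiCoord g S hS.card_eq j)) := by
  classical
  refine ⟨Finset.univ.filter fun t => (S i).orderEmbOfFin (hS.card_eq i) t ∈ S j, ?_, ?_⟩
  · have h3 : (Finset.univ.filter fun t => (S i).orderEmbOfFin (hS.card_eq i) t ∈ S j).card ≤
        (S i ∩ S j).card := by
      refine Finset.card_le_card_of_injOn ((S i).orderEmbOfFin (hS.card_eq i)) (fun t ht => ?_)
        ((S i).orderEmbOfFin (hS.card_eq i)).injective.injOn
      rw [Finset.mem_coe, Finset.mem_filter] at ht
      exact Finset.mem_inter.2 ⟨Finset.orderEmbOfFin_mem _ _ t, ht.2⟩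
    have := hS.card_inter_lt i j hij
    omega
  · rw [kiCoord, MvPolynomial.aeval_rename]
    refine MvPolynomial.aeval_mem_span_pow (Set.mem_insert _ _) (fun t => ?_) g
    rw [Function.comp_apply]
    by_cases ht : (S j).orderEmbOfFin (hS.card_eq j) t ∈ S i
    · obtain ⟨t', ht'⟩ := exists_orderEmbOfFin_eq (hS.card_eq i) ht
      rw [← ht', restrictBlock_emb]
      refine Submodule.subset_span (Or.inr ⟨t', ?_, rfl⟩)
      rw [Finset.mem_coe, Finset.mem_filter, ht']
      exact ⟨Finset.mem_univ _, Finset.orderEmbOfFin_mem _ _ t⟩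
    · rw [restrictBlock_of_notMem _ _ ht, ← mul_one (MvPolynomial.C _),
        ← MvPolynomial.smul_eq_C_mul]
      exact Submodule.smul_mem _ _ (Submodule.subset_span (Or.inl rfl))

/-- The coordinates after the hybrid argument. The distinguished variable is `none`. -/
noncomputable def hybridCoord (g : MvPolynomial (Fin σ) F) (S : Fin n → Finset (Fin μ))
    (hS : ∀ i, (S i).card = σ) (i : Fin n) (e : TX n ⊕ Fin μ → F) (j : Fin n) :
    MvPolynomial (Option (Fin σ)) F :=
  if j = i then MvPolynomial.X none else MvPolynomial.rename some
    (if j < i then MvPolynomial.aeval (restrictBlock (S i) (hS i) fun v => e (Sum.inr v))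
      (kiCoord g S hS j) else MvPolynomial.C (e (Sum.inl (some j))))

/-- Gives non-vanishing: undoing the restriction at the point e recovers a value of the hybrid
chosen to be nonzero. -/
theorem eval_hybridCoord (g : MvPolynomial (Fin σ) F) (S : Fin n → Finset (Fin μ))
    (hS : ∀ i, (S i).card = σ) (i : Fin n) (e : TX n ⊕ Fin μ → F) (f : MvPolynomial (TX n) F) :
    MvPolynomial.eval (fun v : Option (Fin σ) => v.elim (e (Sum.inl (some i))) fun t =>
      e (Sum.inr ((S i).orderEmbOfFin (hS i) t)))
      (MvPolynomial.aeval (fun v : TX n => v.elim (MvPolynomial.C (e (Sum.inl none)))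
        (hybridCoord g S hS i e)) f) = MvPolynomial.eval e (hybrid g S hS i f) := by
  rw [← MvPolynomial.aeval_eq_eval, ← MvPolynomial.aeval_eq_eval]
  rw [hybrid, MvPolynomial.comp_aeval_apply, MvPolynomial.comp_aeval_apply]
  congr 2
  ext v : 1
  rcases v with _ | j
  · simp
  · simp only [Option.elim, hybridCoord, Fin.val_fin_lt]
    by_cases hj : j = i
    · simp [hj]
    · rw [if_neg hj, MvPolynomial.aeval_rename]
      split_ifs
      · rw [MvPolynomial.comp_aeval_apply, MvPolynomial.aeval_rename]
        congr 2
        ext v : 1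
        exact eval_restrictBlock (S i) (hS i) (fun v => e (Sum.inr v)) v
      · simp

/-- Gives the root: putting g for the distinguished variable amounts to replacing one more
coordinate by the generator, then restricting to the block. -/
theorem aeval_hybridCoord (g : MvPolynomial (Fin σ) F) (S : Fin n → Finset (Fin μ))
    (hS : ∀ i, (S i).card = σ) (i : Fin n) (e : TX n ⊕ Fin μ → F) (f : MvPolynomial (TX n) F) :
    MvPolynomial.aeval (fun v : Option (Fin σ) => v.elim g MvPolynomial.X)
      (MvPolynomial.aeval (fun v : TX n => v.elim (MvPolynomial.C (e (Sum.inl none)))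
        (hybridCoord g S hS i e)) f) =
    MvPolynomial.aeval (Sum.elim (fun v : TX n => MvPolynomial.C (e (Sum.inl v)))
      (restrictBlock (S i) (hS i) fun v => e (Sum.inr v))) (hybrid g S hS (i + 1) f) := by
  rw [hybrid, MvPolynomial.comp_aeval_apply, MvPolynomial.comp_aeval_apply]
  congr 2
  ext v : 1
  rcases v with _ | j
  · simp [MvPolynomial.algebraMap_eq]
  · simp only [Option.elim, hybridCoord]
    by_cases hj : j = i
    · subst hj
      rw [if_pos rfl, if_pos (Nat.lt_succ_self _), MvPolynomial.aeval_rename,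
        MvPolynomial.aeval_X, kiCoord, MvPolynomial.aeval_rename]
      refine (MvPolynomial.aeval_X_left_apply g).symm.trans ?_
      congr 2
      ext t : 1
      exact (restrictBlock_emb (S j) (hS j) (fun v => e (Sum.inr v)) t).symm
    · rw [if_neg hj, MvPolynomial.aeval_rename]
      have hj' : j.val ≠ i.val := fun h => hj (Fin.ext h)
      by_cases h : j < i
      · rw [if_pos h, if_pos (by have := Fin.lt_def.1 h; omega), MvPolynomial.aeval_rename]
        exact MvPolynomial.aeval_X_left_apply _
      · rw [if_neg h, if_neg (by rw [Fin.lt_def] at h; omega)]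
        simp [MvPolynomial.algebraMap_eq]

/-- If `f` is nonzero but vanishes on the generator, then `g` is a root of a polynomial obtained
from `f` by substituting coordinates of low complexity. -/
theorem exists_hybrid [Infinite F] (g : MvPolynomial (Fin σ) F) (S : Fin n → Finset (Fin μ))
    (hS : IsDesign n σ μ ρ S) {f : MvPolynomial (TX n) F} (hf : f ≠ 0)
    (h0 : compKI g S hS.card_eq f = 0) :
    ∃ (τ : F) (x : Fin n → MvPolynomial (Option (Fin σ)) F),
      (∀ j, x j = MvPolynomial.X none ∨
        ∃ x', x j = MvPolynomial.rename some x' ∧ IsLowCoord ρ g.totalDegree x') ∧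
      MvPolynomial.aeval (fun v : TX n => v.elim (MvPolynomial.C τ) x) f ≠ 0 ∧
      MvPolynomial.aeval (fun v : Option (Fin σ) => v.elim g MvPolynomial.X)
        (MvPolynomial.aeval (fun v : TX n => v.elim (MvPolynomial.C τ) x) f) = 0 := by
  obtain ⟨i, hi, hi'⟩ := exists_hybrid_switch g S hS.card_eq hf h0
  obtain ⟨e, he⟩ : ∃ e, MvPolynomial.eval e (hybrid g S hS.card_eq i f) ≠ 0 := by
    by_contra! h
    exact hi (MvPolynomial.funext fun e => by rw [h e, map_zero])
  refine ⟨e (Sum.inl none), hybridCoord g S hS.card_eq i e, fun j => ?_, fun h => he ?_, ?_⟩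
  · rw [hybridCoord]
    by_cases hj : j = i
    · exact Or.inl (if_pos hj)
    · refine Or.inr ⟨_, if_neg hj, ?_⟩
      split_ifs
      · exact isLowCoord_kiCoord g hS (Ne.symm hj) _
      · exact isLowCoord_C _ _ _
  · rw [← eval_hybridCoord, h, map_zero]
  · rw [aeval_hybridCoord, hi', map_zero]

end Hybrid

/-! ## Assembling the circuit -/

section Assembly

open scoped Pointwise

variable {F : Type*} [Field F] {n σ : ℕ}

theorem IsLowCoord.gen {ρ d : ℕ} (hρ : 0 < ρ) {x : MvPolynomial (Fin σ) F}
    (hx : IsLowCoord ρ d x) :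
    Gen (Set.range (MvPolynomial.X : Option (Fin σ) → MvPolynomial (Option (Fin σ)) F)) 3
      (ρ ^ d * d + 3 * ρ ^ d) {MvPolynomial.rename some x} := by
  classical
  obtain ⟨K, hK, hx⟩ := hx
  refine Gen.of_mem_span_setPow (insert 1 (K.image fun t => MvPolynomial.X (some t))) ?_ d ?_ ?_
  · intro p hp
    rcases Finset.mem_insert.1 hp with rfl | hp
    · exact Or.inr ⟨1, map_one _⟩
    · obtain ⟨t, -, rfl⟩ := Finset.mem_image.1 hp
      exact Or.inl ⟨some t, rfl⟩
  · have h1 := Finset.card_insert_le (1 : MvPolynomial (Option (Fin σ)) F)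
      (K.image fun t => MvPolynomial.X (some t))
    have h2 : (K.image fun t => (MvPolynomial.X (some t) :
      MvPolynomial (Option (Fin σ)) F)).card ≤ K.card := Finset.card_image_le
    omega
  · have h := Submodule.mem_map_of_mem
      (f := (MvPolynomial.rename (R := F) (some : Fin σ → Option (Fin σ))).toLinearMap) hx
    rw [Submodule.map_span] at h
    have hset : ((insert 1 (K.image fun t => MvPolynomial.X (some t)) :
        Finset (MvPolynomial (Option (Fin σ)) F)) : Set (MvPolynomial (Option (Fin σ)) F)) ^ d =
        MvPolynomial.rename (R := F) (some : Fin σ → Option (Fin σ)) ''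
          ((insert 1 (MvPolynomial.X '' (K : Set (Fin σ)))) ^ d) := by
      rw [Set.image_pow, Set.image_insert_eq, map_one, Set.image_image]
      simp
    rw [hset]
    exact h

theorem IsLowCoord.exists_eq_C {ρ d : ℕ} (hρ : ρ ≤ 1) {x : MvPolynomial (Fin σ) F}
    (hx : IsLowCoord ρ d x) : ∃ a, x = MvPolynomial.C a := by
  obtain ⟨K, hK, hx⟩ := hx
  obtain rfl : K = ∅ := Finset.card_eq_zero.1 (by omega)
  rw [Finset.coe_empty, Set.image_empty, insert_empty_eq, Set.singleton_pow, one_pow,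
    Submodule.mem_span_singleton] at hx
  obtain ⟨a, rfl⟩ := hx
  exact ⟨a, by rw [MvPolynomial.smul_eq_C_mul, mul_one]⟩

theorem Circuit.poly_of_depth_eq_zero {V : Type*} {C : Circuit F V} (h : C.depth = 0) :
    (∃ v, C.poly = MvPolynomial.X v) ∨ ∃ c, C.poly = MvPolynomial.C c := by
  rw [Circuit.depth, C.nodeDepth_eq] at h
  rw [Circuit.poly, C.nodePoly_eq]
  cases hg : C.gate C.out with
  | var v => exact Or.inl ⟨v, rfl⟩
  | const c => exact Or.inr ⟨c, rfl⟩
  | add l => simp [hg] at h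
  | mul l => simp [hg] at h

/-- A polynomial computed in depth `0` has no truncated non-degenerate root other than `0`. -/
theorem approxRoot_eq_zero_of_depth_eq_zero {k : ℕ} {D : Circuit F (TXZ n)} (hD : D.depth = 0)
    {Φ : MvPolynomial (TX n) F} (htr : IsTruncated Φ k) (hnd : IsNondegenerate D.poly Φ)
    (happ : IsApproxRoot D.poly Φ k) : Φ = 0 := by
  -- If A = z, then T^k divides Φ, whose degree in T is below k. In the other cases A does not
  -- involve z and its z-derivative is zero.
  rcases Circuit.poly_of_depth_eq_zero hD with ⟨v, hv⟩ | ⟨c, hc⟩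
  · rcases v with _ | v
    · rw [IsApproxRoot, hv, substZ, MvPolynomial.aeval_X] at happ
      by_contra hne
      obtain ⟨q, rfl⟩ := happ
      have hq : q ≠ 0 := right_ne_zero_of_mul hne
      have h1 : MvPolynomial.degreeOf none
          ((MvPolynomial.X none : MvPolynomial (TX n) F) ^ k * q) = k +
            MvPolynomial.degreeOf none q := by
        rw [MvPolynomial.degreeOf_mul_eq (pow_ne_zero _ (MvPolynomial.X_ne_zero _)) hq,
          MvPolynomial.degreeOf_pow_eq _ _ _ (MvPolynomial.X_ne_zero _),
          MvPolynomial.degreeOf_X_self, mul_one]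
      rw [IsTruncated] at htr
      change MvPolynomial.degreeOf none
          ((MvPolynomial.X none : MvPolynomial (TX n) F) ^ k * q) < k at htr
      omega
    · rw [IsNondegenerate, hv] at hnd
      simp [MvPolynomial.pderiv_X] at hnd
  · rw [IsNondegenerate, hc] at hnd
    simp at hnd

/-- The polynomial `C(T, x, Φ₁, …, Φ_ℓ)` with the coordinates substituted is computed by a circuit
of comparable depth. -/
theorem exists_circuit_substRoots [CharZero F] {ℓ k Δ s ρ d : ℕ} (hk : 0 < k) (hρ : 0 < ρ)
    (D : Fin ℓ → Circuit F (TXZ n)) (Φ : Fin ℓ → MvPolynomial (TX n) F)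
    (hD : ∀ i, (D i).depth ≤ Δ ∧ (D i).size ≤ s) (hreg : ∀ i, TRegularized (D i).poly)
    (hΦ : ∀ i, IsTruncated (Φ i) k ∧ IsNondegenerate (D i).poly (Φ i) ∧
      IsApproxRoot (D i).poly (Φ i) k)
    (C : Circuit F (TX n ⊕ Fin ℓ)) (hC : C.depth ≤ Δ) (hC' : C.size ≤ s) (τ : F)
    (x : Fin n → MvPolynomial (Option (Fin σ)) F)
    (hx : ∀ j, x j = MvPolynomial.X none ∨
        ∃ x', x j = MvPolynomial.rename some x' ∧ IsLowCoord ρ d x') :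
    ∃ E : Circuit F (Option (Fin σ)),
      E.poly = MvPolynomial.aeval (fun v : TX n => v.elim (MvPolynomial.C τ) x)
        (substRoots C.poly Φ) ∧ E.depth ≤ 10 * Δ + 9 ∧
      E.size ≤ (s + 1) * (s + 1) * (ρ ^ d * d + 3 * ρ ^ d) +
        (s + 1) * (448 * s ^ 2 * k ^ 3 + 1100 * k ^ 5 + 2) + 7 * s ^ 2 := by
  classical
  obtain ⟨I, hI, hI'⟩ := C.exists_uses_finset
  choose L hL hL' using fun i => (D i).exists_uses_finset
  -- Only coordinates read by C, or by some D_i whose root is read by C, are computed. Hence the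
  -- cost does not depend on n or ℓ.
  set J : Finset (Fin n) := I.biUnion fun v => match v with
    | .inl none => ∅
    | .inl (some j) => {j}
    | .inr i => (L i).biUnion fun w => match w with
      | some (some j) => {j}
      | _ => ∅ with hJ
  have hJcard : J.card ≤ (s + 1) * (s + 1) := by
    refine (Finset.card_biUnion_le_card_mul _ _ (s + 1) fun v _ => ?_).trans
      (Nat.mul_le_mul_right _ (hI.trans (by omega)))
    rcases v with (_ | j) | i
    · simp
    · simp
    · refine (Finset.card_biUnion_le_card_mul _ _ 1 fun w _ => ?_).trans ?_
      · rcases w with _ | _ | j <;> simp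
      · rw [mul_one]
        exact (hL i).trans (Nat.succ_le_succ (hD i).2)
  have hJC : ∀ j, C.Uses (.inl (some j)) → j ∈ J := fun j hj =>
    Finset.mem_biUnion.2 ⟨_, hI' _ hj, Finset.mem_singleton_self j⟩
  have hJD : ∀ i, .inr i ∈ I → ∀ j, (D i).Uses (some (some j)) → j ∈ J := fun i hi j hj =>
    Finset.mem_biUnion.2 ⟨_, hi, Finset.mem_biUnion.2 ⟨_, hL' i _ hj, Finset.mem_singleton_self j⟩⟩
  set Ψ : Fin ℓ → MvPolynomial (Option (Fin σ)) F := fun i =>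
    MvPolynomial.aeval (fun v : TX n => v.elim (MvPolynomial.C τ) x) (Φ i) with hΨ
  have s1 : Gen (Set.range MvPolynomial.X) 3 ((s + 1) * (s + 1) * (ρ ^ d * d + 3 * ρ ^ d))
      (⋃ j ∈ J, {x j}) := by
    refine Gen.biUnion_const J (fun j _ => ?_) hJcard
    rcases hx j with h | ⟨x', h, hx'⟩
    · refine (Gen.base ?_).mono Set.subset_union_left subset_rfl (Nat.zero_le _) (Nat.zero_le _)
      rw [h, Set.singleton_subset_iff]
      exact Or.inl (Set.mem_range_self none)
    · rw [h]
      exact hx'.gen hρ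
  have hmem1 : ∀ j ∈ J, x j ∈ ⋃ j ∈ J, {x j} := fun j hj =>
    Set.mem_biUnion (t := fun j => {x j}) hj rfl
  have s2 : Gen (⋃ j ∈ J, {x j}) (5 * Δ + 6)
      ((s + 1) * (448 * s ^ 2 * k ^ 3 + 1100 * k ^ 5 + 2))
      (⋃ v ∈ I, {q | ∃ i, v = .inr i ∧ q = Ψ i}) := by
    refine Gen.biUnion_const I (fun v hv => ?_) (hI.trans (by omega))
    rcases v with v | i
    · refine (Gen.base ?_).mono Set.subset_union_left subset_rfl (Nat.zero_le _) (Nat.zero_le _)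
      rintro q ⟨i, hi, -⟩
      exact absurd hi (by simp)
    · refine (Gen.approxRoot (D i) hk (hreg i) (hΦ i).1 (hΦ i).2.1 (hΦ i).2.2 x
        (fun j hj => Or.inl (hmem1 j (hJD i hv j hj))) τ).mono Set.subset_union_left ?_
        (by have := (hD i).1; omega) ?_
      · rintro q ⟨i', hi', rfl⟩
        rw [← Sum.inr.inj hi']
        rfl
      · have := (hD i).2
        gcongr
  have hmem2 : ∀ i, C.Uses (.inr i) → Ψ i ∈ ⋃ v ∈ I, {q | ∃ i, v = .inr i ∧ q = Ψ i} :=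
    fun i hi => Set.mem_biUnion (t := fun v => {q | ∃ i, v = .inr i ∧ q = Ψ i}) (hI' _ hi)
      ⟨i, rfl, rfl⟩
  set val : TX n ⊕ Fin ℓ → MvPolynomial (Option (Fin σ)) F :=
    Sum.elim (fun v => v.elim (MvPolynomial.C τ) x) Ψ with hval
  -- Truncation order 1 with constant polynomials is ordinary substitution into the circuit.
  have s3 := Gen.coeff_aeval (S := (⋃ v ∈ I, {q | ∃ i, v = .inr i ∧ q = Ψ i}) ∪ ⋃ j ∈ J, {x j})
    C (fun v => Polynomial.C (val v)) 1 fun v hv i _ => coeff_C_mem (by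
      rcases v with (_ | j) | i
      · exact Or.inr ⟨τ, rfl⟩
      · exact Or.inl (Or.inr (hmem1 j (hJC j hv)))
      · exact Or.inl (Or.inl (hmem2 i hv))) i
  have heq : (MvPolynomial.aeval (fun v => Polynomial.C (val v)) C.poly).coeff 0 =
      MvPolynomial.aeval (fun v : TX n => v.elim (MvPolynomial.C τ) x) (substRoots C.poly Φ) := by
    have h1 : MvPolynomial.aeval (fun v => Polynomial.C (val v)) C.poly =
        Polynomial.C (MvPolynomial.aeval val C.poly) :=
      (RingHom.map_mvAeval (F := F) (A := MvPolynomial (Option (Fin σ)) F)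
        (B := Polynomial (MvPolynomial (Option (Fin σ)) F)) Polynomial.C (fun _ => rfl) val _).symm
    rw [h1, Polynomial.coeff_C_zero, substRoots, MvPolynomial.comp_aeval_apply]
    congr 2
    ext v : 1
    rcases v with v | i
    · simp [hval]
    · simp [hval, hΨ]
  have s4 : Gen (Set.range MvPolynomial.X) (10 * Δ + 9)
      ((s + 1) * (s + 1) * (ρ ^ d * d + 3 * ρ ^ d) +
        (s + 1) * (448 * s ^ 2 * k ^ 3 + 1100 * k ^ 5 + 2) + 7 * s ^ 2)
      {MvPolynomial.aeval (fun v : TX n => v.elim (MvPolynomial.C τ) x)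
        (substRoots C.poly Φ)} := by
    -- Depth 3 for the coordinates, 5Δ + 6 for the roots, 5Δ for C. The coordinates are kept since C
    -- may read them directly.
    refine ((s1.comp s2.keep).comp s3).mono Set.subset_union_left ?_ (by omega) ?_
    · rintro q rfl
      exact ⟨0, Nat.zero_lt_one, heq.symm⟩
    · rw [one_pow, mul_one]
      gcongr
  exact s4.exists_circuit

theorem natDegree_expandHom_le {ρ d : ℕ} (g : MvPolynomial (Fin σ) F) (τ : F)
    (x : Fin n → MvPolynomial (Option (Fin σ)) F)
    (hx : ∀ j, x j = MvPolynomial.X none ∨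
        ∃ x', x j = MvPolynomial.rename some x' ∧ IsLowCoord ρ d x') (f : MvPolynomial (TX n) F) :
    (expandHom g (MvPolynomial.aeval (fun v : TX n => v.elim (MvPolynomial.C τ) x) f)).natDegree ≤
      f.totalDegree := by
  rw [MvPolynomial.comp_aeval_apply]
  refine natDegree_mvAeval_le _ (fun v => ?_) f
  rcases v with _ | j
  · rw [Option.elim, ← MvPolynomial.algebraMap_eq, AlgHom.commutes, Polynomial.algebraMap_apply,
      Polynomial.natDegree_C]
    exact Nat.zero_le _
  · rw [Option.elim]
    rcases hx j with h | ⟨x', h, -⟩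
    · rw [h, expandHom, MvPolynomial.aeval_X]
      exact Polynomial.natDegree_add_le_of_degree_le
        ((Polynomial.natDegree_C _).trans_le (Nat.zero_le _)) Polynomial.natDegree_X_le
    · have : expandHom g (MvPolynomial.rename some x') = Polynomial.C x' := by
        rw [expandHom, MvPolynomial.aeval_rename]
        have h1 := RingHom.map_mvAeval (F := F) (A := MvPolynomial (Fin σ) F)
          (B := Polynomial (MvPolynomial (Fin σ) F)) Polynomial.C (fun _ => rfl)
          MvPolynomial.X x'
        rw [MvPolynomial.aeval_X_left_apply] at h1
        exact h1.symm
      rw [h, this, Polynomial.natDegree_C]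
      exact Nat.zero_le _

/-- For ρ ≤ 1 all coordinates are polynomials in the distinguished variable alone, so g is algebraic
over F and therefore constant. This case stands apart because powers of ρ ≤ 1 cannot absorb the
degree of g in the size bound. -/
theorem exists_eq_C_of_card_le_one [Infinite F] {ρ d : ℕ} (hρ : ρ ≤ 1) {g : MvPolynomial (Fin σ) F}
    {τ : F} {x : Fin n → MvPolynomial (Option (Fin σ)) F}
    (hx : ∀ j, x j = MvPolynomial.X none ∨
        ∃ x', x j = MvPolynomial.rename some x' ∧ IsLowCoord ρ d x') {f : MvPolynomial (TX n) F}
    (hne : MvPolynomial.aeval (fun v : TX n => v.elim (MvPolynomial.C τ) x) f ≠ 0)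
    (h0 : MvPolynomial.aeval (fun v : Option (Fin σ) => v.elim g MvPolynomial.X)
        (MvPolynomial.aeval (fun v : TX n => v.elim (MvPolynomial.C τ) x) f) = 0) :
    ∃ c, g = MvPolynomial.C c := by
  have hy : ∀ j, ∃ y : Polynomial F, x j = Polynomial.aeval (MvPolynomial.X none) y := by
    intro j
    rcases hx j with h | ⟨x', h, hx'⟩
    · exact ⟨Polynomial.X, by rw [h, Polynomial.aeval_X]⟩
    · obtain ⟨a, rfl⟩ := hx'.exists_eq_C hρ
      exact ⟨Polynomial.C a, by rw [h, Polynomial.aeval_C, MvPolynomial.rename_C]; rfl⟩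
  choose y hy using hy
  set p : Polynomial F := MvPolynomial.aeval (fun v : TX n => v.elim (Polynomial.C τ) y) f with hp
  have hP : MvPolynomial.aeval (fun v : TX n => v.elim (MvPolynomial.C τ) x) f =
      Polynomial.aeval (MvPolynomial.X none) p := by
    rw [hp, MvPolynomial.comp_aeval_apply]
    congr 2
    ext v : 1
    rcases v with _ | j
    · rw [Option.elim, Option.elim, Polynomial.aeval_C]; rfl
    · exact hy j
  rw [hP] at hne h0
  refine MvPolynomial.exists_eq_C_of_aeval_eq_zero (p := p) ?_ ?_
  · rintro h
    rw [h, map_zero] at hne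
    exact hne rfl
  · rw [← Polynomial.aeval_algHom_apply, MvPolynomial.aeval_X] at h0
    exact h0

end Assembly

/-! ### The size estimate and the conclusion -/

theorem size_bound {U s k D d M : ℕ} (hU : 12 ≤ U) (hs : s + 1 ≤ U) (hk : k ≤ U) (hD : D ≤ U)
    (hd : d + 1 ≤ U) (hM : M ≤ U ^ 2) {e₁ e₂ : ℕ}
    (he₁ : e₁ = (s + 1) * (s + 1) * M + (s + 1) * (448 * s ^ 2 * k ^ 3 + 1100 * k ^ 5 + 2) +
      7 * s ^ 2) (he₂ : e₂ = 7 * e₁ ^ 2 * D ^ 2) :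
    (e₂ + 1) * 2 + (448 * e₂ ^ 2 * (d + 1) ^ 3 + 1100 * (d + 1) ^ 5 + 2) ≤ U ^ 54 := by
  -- All parameters are bounded by powers of U, and constants are absorbed too: 7 ≤ U, both 448 and
  -- 1100 are at most U³, and each short sum of powers costs one factor 12 ≤ U.
  have hU3 : 1100 ≤ U ^ 3 := (by norm_num : 1100 ≤ 12 ^ 3).trans (Nat.pow_le_pow_left hU 3)
  have hmono : ∀ {a b : ℕ}, a ≤ b → U ^ a ≤ U ^ b := fun h => Nat.pow_le_pow_right (by omega) h
  have hstep : ∀ a, 12 * U ^ a ≤ U ^ (a + 1) := fun a => by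
    rw [pow_succ, mul_comm]
    exact Nat.mul_le_mul_left _ hU
  have hs' : s ≤ U := by omega
  have h₁ : e₁ ≤ U ^ 10 := by
    calc e₁ ≤ U * U * U ^ 2 + U * (U ^ 3 * U ^ 2 * U ^ 3 + U ^ 3 * U ^ 5 + U ^ 3) +
          U ^ 3 * U ^ 2 := by
          rw [he₁]
          gcongr <;> omega
      _ = U ^ 4 + 2 * U ^ 9 + U ^ 4 + U ^ 5 := by ring
      _ ≤ 12 * U ^ 9 := by
        have := hmono (show 4 ≤ 9 by omega)
        have := hmono (show 5 ≤ 9 by omega)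
        omega
      _ ≤ U ^ 10 := hstep 9
  have h₂ : e₂ ≤ U ^ 23 := by
    calc e₂ ≤ U * (U ^ 10) ^ 2 * U ^ 2 := by
          rw [he₂]
          gcongr
          omega
      _ = U ^ 23 := by ring
  calc _ ≤ (U ^ 23 + 1) * 2 + (U ^ 3 * (U ^ 23) ^ 2 * U ^ 3 + U ^ 3 * U ^ 5 + U) := by
        gcongr <;> omega
    _ = 2 * U ^ 23 + 2 + U ^ 52 + U ^ 8 + U := by ring
    _ ≤ 12 * U ^ 53 := by
      have h1 := hmono (show 23 ≤ 53 by omega)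
      have h2 := hmono (show 52 ≤ 53 by omega)
      have h3 := hmono (show 8 ≤ 53 by omega)
      have h4 := hmono (show 1 ≤ 53 by omega)
      rw [pow_one] at h4
      omega
    _ ≤ U ^ 54 := hstep 53

/-- If all circuits have depth `0`, then the hard polynomial vanishes. -/
theorem eq_zero_of_depth_eq_zero {F : Type*} [Field F] {n ℓ k σ μ : ℕ}
    (D : Fin ℓ → Circuit F (TXZ n)) (Φ : Fin ℓ → MvPolynomial (TX n) F)
    (hD : ∀ i, (D i).depth = 0)
    (hΦ : ∀ i, IsTruncated (Φ i) k ∧ IsNondegenerate (D i).poly (Φ i) ∧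
      IsApproxRoot (D i).poly (Φ i) k)
    (g : MvPolynomial (Fin σ) F) (S : Fin n → Finset (Fin μ)) (hS : ∀ i, (S i).card = σ)
    (C : Circuit F (TX n ⊕ Fin ℓ)) (hC : C.depth = 0) (hne : substRoots C.poly Φ ≠ 0)
    (h0 : compKI g S hS (substRoots C.poly Φ) = 0) : g = 0 := by
  -- C is a leaf. T and nonzero constants survive on the generator, a root Φ_i would be zero, and
  -- for a variable x_j the vanishing coordinate is a renamed copy of g.
  rcases Circuit.poly_of_depth_eq_zero hC with ⟨(_ | j) | i, hv⟩ | ⟨c, hc⟩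
  · rw [hv] at h0
    simp [substRoots, compKI] at h0
  · rw [hv] at h0
    simp only [substRoots, compKI, MvPolynomial.aeval_X, Sum.elim_inl, Option.elim, kiCoord] at h0
    rw [← map_zero (MvPolynomial.rename (R := F) (some : Fin μ → TX μ))] at h0
    have h1 := MvPolynomial.rename_injective _ (Option.some_injective _) h0
    rw [← map_zero (MvPolynomial.rename (R := F) ((S j).orderEmbOfFin (hS j)))] at h1
    exact MvPolynomial.rename_injective _ ((S j).orderEmbOfFin (hS j)).injective h1
  · rw [hv] at hne
    simp only [substRoots, MvPolynomial.aeval_X, Sum.elim_inr] at hne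
    exact absurd (approxRoot_eq_zero_of_depth_eq_zero (hD i) (hΦ i).1 (hΦ i).2.1 (hΦ i).2.2) hne
  · rw [hc] at hne h0
    simp only [substRoots, compKI, MvPolynomial.aeval_C, MvPolynomial.algebraMap_eq] at hne h0
    rw [MvPolynomial.C_eq_zero] at h0
    exact absurd (by rw [h0, map_zero]) hne

theorem theorem8p10 :
    ∃ (c : ℕ) (p : MvPolynomial (Fin 3) ℕ) (q : Polynomial ℕ),
      ∀ (F : Type*) [Field F] [CharZero F] (n ℓ k Δ s σ μ ρ : ℕ),
        1 < k →
        ∀ (A : Fin ℓ → MvPolynomial (TXZ n) F) (Φ : Fin ℓ → MvPolynomial (TX n) F),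
          (∀ i, ∃ D : Circuit F (TXZ n), D.poly = A i ∧ D.depth ≤ Δ ∧ D.size ≤ s) →
          (∀ i, TRegularized (A i) ∧ MonicInZ (A i)) →
          (∀ i, IsTruncated (Φ i) k ∧ IsNondegenerate (A i) (Φ i) ∧
            IsApproxRoot (A i) (Φ i) k) →
          ∀ (S : Fin n → Finset (Fin μ)) (hS : IsDesign n σ μ ρ S)
            (g : MvPolynomial (Fin σ) F) (C : Circuit F (TX n ⊕ Fin ℓ)),
            C.depth ≤ Δ → C.size ≤ s →
            substRoots C.poly Φ ≠ 0 →
            compKI g S hS.card_eq (substRoots C.poly Φ) = 0 →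
            ∃ G : Circuit F (Fin σ), G.poly = g ∧ G.depth ≤ c * Δ ∧
              (G.size : ℝ) ≤
                (MvPolynomial.eval ![s, (substRoots C.poly Φ).totalDegree, k] p : ℕ) *
                  ((ρ : ℝ) * Real.logb 2 k) ^ (q.eval g.totalDegree) := by
  -- For Δ ≥ 1 the depth is at most 25(10Δ + 9) + 7 = 250Δ + 232 ≤ 482Δ. The exponent 54 is that of
  -- `size_bound`, with U = (s + deg C' + k + 4) ρ^(d+1).
  refine ⟨482, (MvPolynomial.X 0 + MvPolynomial.X 1 + MvPolynomial.X 2 + 4) ^ 54,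
    54 * (Polynomial.X + 1), ?_⟩
  intro F _ _ n ℓ k Δ s σ μ ρ hk A Φ hA hreg hΦ S hS g C hCΔ hCs hne h0
  choose D hDA hDΔ hDs using hA
  obtain rfl : (fun i => (D i).poly) = A := funext hDA
  have hlog : 1 ≤ Real.logb 2 k := by
    rw [Real.le_logb_iff_rpow_le (by norm_num) (by positivity), Real.rpow_one]
    exact_mod_cast hk
  have hconst : ∀ a : F, g = MvPolynomial.C a → ∃ G : Circuit F (Fin σ), G.poly = g ∧
      G.depth ≤ 482 * Δ ∧ (G.size : ℝ) ≤
        (MvPolynomial.eval ![s, (substRoots C.poly Φ).totalDegree, k]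
          ((MvPolynomial.X 0 + MvPolynomial.X 1 + MvPolynomial.X 2 + 4) ^ 54) : ℕ) *
          ((ρ : ℝ) * Real.logb 2 k) ^ ((54 * (Polynomial.X + 1) : Polynomial ℕ).eval
            g.totalDegree) := fun a ha => by
    refine ⟨Circuit.ofConst a, by rw [Circuit.ofConst_poly, ha], ?_, ?_⟩
    · rw [Circuit.ofConst_depth]
      exact Nat.zero_le _
    · rw [Circuit.ofConst_size, Nat.cast_zero]
      exact mul_nonneg (Nat.cast_nonneg _)
        (pow_nonneg (mul_nonneg (Nat.cast_nonneg _) (zero_le_one.trans hlog)) _)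
  -- For Δ = 0 no additive constant is allowed in the depth, so this case needs its own argument.
  rcases Nat.eq_zero_or_pos Δ with rfl | hΔ
  · refine hconst 0 ?_
    rw [map_zero]
    exact eq_zero_of_depth_eq_zero D Φ (fun i => Nat.le_zero.1 (hDΔ i)) hΦ g S hS.card_eq C
      (Nat.le_zero.1 hCΔ) hne h0
  obtain ⟨τ, x, hx, hPne, hP0⟩ := exists_hybrid g S hS hne h0
  rcases Nat.lt_or_ge 1 ρ with hρ | hρ
  · obtain ⟨E, hE, hEdepth, hEsize⟩ := exists_circuit_substRoots (by omega) (by omega) D Φ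
      (fun i => ⟨hDΔ i, hDs i⟩) (fun i => (hreg i).1) hΦ C hCΔ hCs τ x hx
    rw [← hE] at hPne hP0
    have hdeg := natDegree_expandHom_le g τ x hx (substRoots C.poly Φ)
    rw [← hE] at hdeg
    set d := g.totalDegree with hd
    set t := (substRoots C.poly Φ).totalDegree with ht
    obtain ⟨e₁, he₁⟩ : ∃ e, e = (s + 1) * (s + 1) * (ρ ^ d * d + 3 * ρ ^ d) +
      (s + 1) * (448 * s ^ 2 * k ^ 3 + 1100 * k ^ 5 + 2) + 7 * s ^ 2 := ⟨_, rfl⟩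
    obtain ⟨e₂, he₂⟩ : ∃ e, e = 7 * e₁ ^ 2 * t ^ 2 := ⟨_, rfl⟩
    rw [← he₁] at hEsize
    obtain ⟨G, hG, hGdepth, hGsize⟩ := E.exists_circuit_root_of_ne_zero hPne hP0 hdeg
      (show 7 * E.size ^ 2 * t ^ 2 ≤ e₂ by rw [he₂]; gcongr)
    refine ⟨G, hG, hGdepth.trans (by omega), ?_⟩
    -- Since ρ ≥ 2, the power ρ^(d+1) dominates the degree d; it is at least 2, and s + t + k + 4 ≥
    -- 6, so U ≥ 12.
    have hdρ : d + 2 ≤ ρ ^ (d + 1) := Nat.lt_pow_self hρ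
    have hρd : ρ ^ d ≤ ρ ^ (d + 1) := Nat.pow_le_pow_right (by omega) (Nat.le_succ d)
    have hU₁ : ρ ^ (d + 1) * 6 ≤ (s + t + k + 4) * ρ ^ (d + 1) := by
      rw [mul_comm]
      exact Nat.mul_le_mul_right _ (by omega)
    have hU₂ : s + t + k + 4 ≤ (s + t + k + 4) * ρ ^ (d + 1) :=
      Nat.le_mul_of_pos_right _ (by positivity)
    set U := (s + t + k + 4) * ρ ^ (d + 1) with hU
    have hbound := size_bound (U := U) (s := s) (k := k) (D := t) (d := d)
      (M := ρ ^ d * d + 3 * ρ ^ d) (by omega) (by omega) (by omega) (by omega) (by omega) (by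
        calc ρ ^ d * d + 3 * ρ ^ d = ρ ^ d * (d + 3) := by ring
          _ ≤ U * U := Nat.mul_le_mul (by omega) (by omega)
          _ = U ^ 2 := (sq U).symm) he₁ he₂
    refine (Nat.cast_le.2 (hGsize.trans hbound)).trans ?_
    have e1 : MvPolynomial.eval ![s, t, k]
        ((MvPolynomial.X 0 + MvPolynomial.X 1 + MvPolynomial.X 2 + 4) ^ 54) =
        (s + t + k + 4) ^ 54 := by
      simp
    have e2 : (54 * (Polynomial.X + 1) : Polynomial ℕ).eval d = (d + 1) * 54 := by
      simp [mul_comm]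
    rw [e1, e2]
    have hV : ((U ^ 54 : ℕ) : ℝ) =
        (((s + t + k + 4) ^ 54 : ℕ) : ℝ) * (ρ : ℝ) ^ ((d + 1) * 54) := by
      rw [hU, mul_pow, ← pow_mul, Nat.cast_mul, Nat.cast_pow ρ]
    rw [hV]
    refine mul_le_mul_of_nonneg_left (pow_le_pow_left₀ (Nat.cast_nonneg _) ?_ _)
      (Nat.cast_nonneg _)
    -- The size bound already holds with ρ alone; since k ≥ 2, the factor log₂ k is at least 1 and
    -- only enlarges it.
    exact le_mul_of_one_le_right (Nat.cast_nonneg _) hlog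
  · obtain ⟨a, ha⟩ := exists_eq_C_of_card_le_one hρ hx hPne hP0
    exact hconst a ha
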